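/- Consider the linear system $x(t+1)=Ax(t)+Bu(t)+w(t)$, $x(0)=0$, with state $x(t)\in\mathbb R^n$ ($n\ge 1$), input $u(t)\in\mathbb R^m$ and noise $w(t)\in\mathbb R^n$, and put $\Theta^\ast=[A,B]^T\in\mathbb R^{(n+m)\times n}$ and $z(t)=(x(t),u(t))\in\mathbb R^{n+m}$. Fix a horizon $T\ge 1$. The inputs and noises $u(0),\dots,u(T-1),w(0),\dots,w(T-1)$ are independent and zero-mean; each $u(t)$ is sub-Gaussian with parameter $\sigma_u>0$ and each $w(t)$ with parameter $\sigma_w>0$, where a zero-mean random vector $x$ is sub-Gaussian with parameter $\sigma$ if $\mathbb E e^{\lambda\langle v,x\rangle}\le e^{\lambda^2\sigma^2/2}$ for all unit vectors $v$ and all $\lambda\in\mathbb R$. Let $\Sigma$ be the covariance matrix of $z(T-1)$, let $\gamma_{\min}(\Sigma)$ and $\gamma_{\max}(\Sigma)$ be its smallest and largest singular values, and assume $\gamma_{\min}(\Sigma)>0$. Call $\beta>0$ a deviation constant if for all $N\ge 1$ and $\delta>0$ the sample covariance matrix $\widehat\Sigma=\frac1N\sum_{i=1}^N z_iz_i^T$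 of $N$ i.i.d. copies $z_i$ of $z(T-1)$ satisfies $$\mathbb P\Big[\|\widehat\Sigma-\Sigma\|_{\mathrm{op}}\ge 16\sqrt6\,\beta^2\Big(\sqrt{\tfrac{n+m}{N}}+\tfrac{n+m}{N}\Big)+\delta\beta^2\Big]\le e^{-N\min\{\delta/(16\sqrt2),\,\delta^2/512\}}.$$ Suppose that, for some $q\in[0,1]$ and $R_q>0$, $\Theta^\ast\in\mathbb B(R_q)=\{\Theta\in\mathbb R^{(n+m)\times n}:\sum_{j=1}^n|\sigma_j(\Theta)|^q\le R_q\}$, where $\sigma_j(\Theta)$ are the singular values and $0^0:=0$ (so that for $q=0$ the sum is the rank). There are universal constants $c_1,c_5,c_6>0$ such that, for every such system, a deviation constant exists, and for every deviation constant $\beta$ the following holds. Let $N\ge \frac{c_1\beta^4}{\gamma_{\min}(\Sigma)^2}(n+m)$, take $N$ independent copies (trials) $i=1,\dots,N$ of the system, and let $X\in\mathbb R^{N\times n}$ and $Z\in\mathbb R^{N\times(n+m)}$ have the rows $x^{(i)}(T)^T$ and $z^{(i)}(T-1)^T$, respectively. Put $\alpha=\sqrt{2\sigma_w^2[(32\sqrt6+1)\beta^2+\gamma_{\max}(\Sigma)]}$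 and $\lambda_N=4\alpha\sqrt{\frac{n+m}{N}}$. Then with probability at least $1-c_5e^{-c_6(n+m)}$ the program $$\min_{\Theta\in\mathbb R^{(n+m)\times n}}\Big\{\tfrac1{2N}\|X-Z\Theta\|_{\mathrm F}^2+\lambda_N\|\Theta\|_{\mathrm{nuc}}\Big\}$$ has a solution, and every solution $\widehat\Theta$ satisfies $$\|\widehat\Theta-\Theta^\ast\|_{\mathrm{op}}\le\frac{24\alpha}{\gamma_{\min}(\Sigma)}\sqrt{\frac{n+m}{N}}.$$ -/

import Mathlib

open MeasureTheory ProbabilityTheory Matrix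
open scoped ENNReal

namespace VARX

noncomputable section

/-! ## Singular values and matrix norms -/

/-- The `k`-th largest singular value of a real matrix, numbered from `k = 0` and counted with
multiplicity. -/
def singVal {p q : Type*} [Fintype p] [Fintype q] [DecidableEq q]
    (M : Matrix p q ℝ) (k : ℕ) : ℝ :=
  (Matrix.toEuclideanLin M).singularValues k

/-- The nuclear norm, the sum of all singular values (for a matrix with more columns than rows the
surplus singular values are zero). -/
def nuclearNorm {p q : Type*} [Fintype p] [Fintype q] [DecidableEq q]
    (M : Matrix p q ℝ) : ℝ :=
  ∑ k ∈ Finset.range (Fintype.card q), singVal M k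

open scoped Matrix.Norms.L2Operator in
/-- The operator norm of a matrix with respect to the Euclidean norms. -/
def opNorm {p q : Type*} [Fintype p] [Fintype q] [DecidableEq q] (M : Matrix p q ℝ) : ℝ := ‖M‖

/-- The largest singular value. -/
def gammaMax {p : Type*} [Fintype p] [DecidableEq p] (M : Matrix p p ℝ) : ℝ := singVal M 0

/-- The smallest singular value. -/
def gammaMin {p : Type*} [Fintype p] [DecidableEq p] (M : Matrix p p ℝ) : ℝ :=
  singVal M (Fintype.card p - 1)

/-- The `ℓ_q`-"ball" `𝔹(R_q)` of matrices: `∑ⱼ σⱼ(Θ)^q ≤ R`, with the convention `0 ^ 0 = 0`, so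
that for `q = 0` the sum is the rank. -/
def lqBall {p : Type*} [Fintype p] {n : ℕ} (q R : ℝ) : Set (Matrix p (Fin n) ℝ) :=
  {Θ | ∑ k ∈ Finset.range n, (if singVal Θ k = 0 then 0 else |singVal Θ k| ^ q) ≤ R}

/-! ## Sub-Gaussian vectors, covariance matrices -/

/-- `μ` is the law of a zero-mean sub-Gaussian random vector with parameter `σ > 0`:
`𝔼 exp (l * ⟨v, x⟩) ≤ exp (l ^ 2 * σ ^ 2 / 2)` for every unit vector `v` and every real `l`. -/
def IsSubGaussianLaw {d : ℕ} (μ : Measure (EuclideanSpace ℝ (Fin d))) (σ : ℝ) : Prop :=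
  0 < σ ∧ ∫ x, x ∂μ = 0 ∧
    ∀ v : EuclideanSpace ℝ (Fin d), ‖v‖ = 1 →
      HasSubgaussianMGF (fun x => inner ℝ v x) (Real.toNNReal (σ ^ 2)) μ

/-- The covariance matrix of a law on Euclidean space. -/
def covMatrix {p : Type*} [Fintype p] (ρ : Measure (EuclideanSpace ℝ p)) : Matrix p p ℝ :=
  Matrix.of fun i j => covariance (fun z : EuclideanSpace ℝ p => z i) (fun z => z j) ρ

/-- The sample covariance matrix `(1 / N) * Zᵀ * Z`. -/
def sampleCov {p : Type*} [Fintype p] {N : ℕ} (Z : Matrix (Fin N) p ℝ) : Matrix p p ℝ :=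
  ((1 : ℝ) / N) • (Zᵀ * Z)

/-- `β` is a constant for which the sample covariance matrix of every number `N` of i.i.d. rows
with law `ρ` satisfies, for every `δ > 0`, the deviation bound
`ℙ (‖Σ̂ - Σ‖ ≥ 16 √6 β² (√(d / N) + d / N) + δ β²) ≤ exp (-N min (δ / (16 √2)) (δ² / 512))`,
where `d` is the dimension. -/
def IsDeviationConstant {p : Type*} [Fintype p] [DecidableEq p]
    (ρ : Measure (EuclideanSpace ℝ p)) (β : ℝ) : Prop :=
  0 < β ∧ ∀ N : ℕ, 1 ≤ N → ∀ δ : ℝ, 0 < δ →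
    Measure.pi (fun _ : Fin N => ρ)
      {Z | 16 * √6 * β ^ 2 * (√((Fintype.card p : ℝ) / N) + (Fintype.card p : ℝ) / N) + δ * β ^ 2
          ≤ opNorm (sampleCov (Matrix.of fun i j => Z i j) - covMatrix ρ)}
      ≤ ENNReal.ofReal (Real.exp (-(N * min (δ / (16 * √2)) (δ ^ 2 / 512))))

/-! ## The system `x (t + 1) = A x (t) + B u (t) + w (t)`, `x (0) = 0` -/

/-- One realization of the inputs and the noises of one trial: the pairs `(u (t), w (t))` for
`t = 0, …, T - 1`. -/
abbrev Trial (n m T : ℕ) : Type :=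
  Fin T → EuclideanSpace ℝ (Fin m) × EuclideanSpace ℝ (Fin n)

variable {n m T : ℕ}

/-- The input `u (t)`; only the times `t < T` matter. -/
def Trial.input (ξ : Trial n m T) (t : ℕ) : Fin m → ℝ :=
  if h : t < T then (ξ ⟨t, h⟩).1 else 0

/-- The noise `w (t)`; only the times `t < T` matter. -/
def Trial.noise (ξ : Trial n m T) (t : ℕ) : Fin n → ℝ :=
  if h : t < T then (ξ ⟨t, h⟩).2 else 0

/-- The state of the system, started at `x (0) = 0`. -/
def state (A : Matrix (Fin n) (Fin n) ℝ) (B : Matrix (Fin n) (Fin m) ℝ) (ξ : Trial n m T) :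
    ℕ → Fin n → ℝ
  | 0 => 0
  | t + 1 => A *ᵥ state A B ξ t + B *ᵥ ξ.input t + ξ.noise t

/-- `z (t) = (x (t), u (t))`. -/
def regressor (A : Matrix (Fin n) (Fin n) ℝ) (B : Matrix (Fin n) (Fin m) ℝ) (ξ : Trial n m T)
    (t : ℕ) : EuclideanSpace ℝ (Fin n ⊕ Fin m) :=
  WithLp.toLp 2 (Sum.elim (state A B ξ t) (ξ.input t))

/-- `Θ* = [A, B]ᵀ`. -/
def theta (A : Matrix (Fin n) (Fin n) ℝ) (B : Matrix (Fin n) (Fin m) ℝ) :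
    Matrix (Fin n ⊕ Fin m) (Fin n) ℝ :=
  (Matrix.fromCols A B)ᵀ

/-- The law of one trial: all inputs and noises are independent, `u (t)` has law `Pu t` and
`w (t)` has law `Pw t`. -/
def trialLaw (Pu : Fin T → Measure (EuclideanSpace ℝ (Fin m)))
    (Pw : Fin T → Measure (EuclideanSpace ℝ (Fin n))) : Measure (Trial n m T) :=
  Measure.pi fun t => (Pu t).prod (Pw t)

/-- The law of `z (T - 1)`. -/
def rowLaw (A : Matrix (Fin n) (Fin n) ℝ) (B : Matrix (Fin n) (Fin m) ℝ)
    (Pu : Fin T → Measure (EuclideanSpace ℝ (Fin m)))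
    (Pw : Fin T → Measure (EuclideanSpace ℝ (Fin n))) :
    Measure (EuclideanSpace ℝ (Fin n ⊕ Fin m)) :=
  (trialLaw Pu Pw).map fun ξ => regressor A B ξ (T - 1)

/-! ## The regularized estimator -/

/-- The matrix `X` with rows `x⁽ⁱ⁾ (T)`. -/
def responseMatrix {N : ℕ} (A : Matrix (Fin n) (Fin n) ℝ) (B : Matrix (Fin n) (Fin m) ℝ)
    (ξ : Fin N → Trial n m T) : Matrix (Fin N) (Fin n) ℝ :=
  Matrix.of fun i => state A B (ξ i) T

/-- The matrix `Z` with rows `z⁽ⁱ⁾ (T - 1)`. -/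
def measurementMatrix {N : ℕ} (A : Matrix (Fin n) (Fin n) ℝ) (B : Matrix (Fin n) (Fin m) ℝ)
    (ξ : Fin N → Trial n m T) : Matrix (Fin N) (Fin n ⊕ Fin m) ℝ :=
  Matrix.of fun i j => regressor A B (ξ i) (T - 1) j

/-- The least-squares cost `(1 / (2 N)) * ‖X - Z Θ‖_F²`. -/
def cost {N : ℕ} (X : Matrix (Fin N) (Fin n) ℝ) (Z : Matrix (Fin N) (Fin n ⊕ Fin m) ℝ)
    (Θ : Matrix (Fin n ⊕ Fin m) (Fin n) ℝ) : ℝ :=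
  1 / (2 * (N : ℝ)) * ∑ i, ∑ j, (X - Z * Θ) i j ^ 2

/-- `Θhat` is a solution of the program that minimizes the cost plus `lam` times the nuclear
norm. -/
def IsSolution {N : ℕ} (X : Matrix (Fin N) (Fin n) ℝ) (Z : Matrix (Fin N) (Fin n ⊕ Fin m) ℝ)
    (lam : ℝ) (Θhat : Matrix (Fin n ⊕ Fin m) (Fin n) ℝ) : Prop :=
  ∀ Θ : Matrix (Fin n ⊕ Fin m) (Fin n) ℝ,
    cost X Z Θhat + lam * nuclearNorm Θhat ≤ cost X Z Θ + lam * nuclearNorm Θ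

/-- `α = √(2 σ_w² ((32 √6 + 1) β² + γ_max (Σ)))`. -/
def alpha {p : Type*} [Fintype p] [DecidableEq p] (σw β : ℝ) (S : Matrix p p ℝ) : ℝ :=
  √(2 * σw ^ 2 * ((32 * √6 + 1) * β ^ 2 + gammaMax S))

end

end VARX

/-! Write d = n + m, Σ̂ = ZᵀZ/N, and let W have the rows w⁽ⁱ⁾(T-1), so that X = ZΘ* + W. The error
bound is deterministic once two facts hold: ‖Σ̂ - Σ‖ ≤ γ_min/2, and ‖ZᵀW/N‖ ≤ κ with κ = 8α√(d/N) =
2λ_N.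

The operator norm is dual to the nuclear norm, so optimality of Θ̂ forces ‖Zᵀ(X - ZΘ̂)/N‖ ≤ λ_N.
Rank-one perturbations suffice to see this (`IsSolution.residual_le`). Substituting X gives ‖Σ̂(Θ̂ -
Θ*)‖ ≤ λ_N + κ = 12α√(d/N). Since Σ̂ expands every vector by at least γ_min/2, the factor 24 results
(`IsSolution.opNorm_sub_le`).

For the cross term, w(T-1) is independent of z(T-1), so each bilinear form of ZᵀW has a Chernoff
bound whose variance proxy is the quadratic form of Σ̂. It is controlled on the event ‖Σ̂‖ ≤ V
(`measure_regressor_noise_le`), and α² = 2σ_w²V for V = (32√6+1)β² + γ_max. A union over 1/2-nets of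
both spheres costs only 5^(n+m) · 5^n.

For Σ̂, the deviation bound is used with δ = √(d/N), which requires N ≥ d. This follows from the
sample size condition, because a deviation constant cannot be small compared with γ_min: fewer than
d samples give a singular Σ̂ (`IsDeviationConstant.gammaMin_lt`).

A deviation constant exists because β may depend on the system: the entries of Σ̂ - Σ are averages
of centered sub-exponential variables, so Bernstein's inequality and a union over entries suffice
for large β (`exists_isDeviationConstant`). -/

namespace VARX

/-! ## Singular values of linear maps -/

section SingularValues

open scoped InnerProductSpace
open Module

variable {E F : Type*} [NormedAddCommGroup E] [InnerProductSpace ℝ E] [FiniteDimensional ℝ E]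
  [NormedAddCommGroup F] [InnerProductSpace ℝ F] [FiniteDimensional ℝ F]

/-- An orthonormal basis of right singular vectors. -/
theorem exists_singular_basis (T : E →ₗ[ℝ] F) {d : ℕ} (hd : finrank ℝ E = d) :
    ∃ b : OrthonormalBasis (Fin d) ℝ E, ∀ k l : Fin d,
      ⟪T (b k), T (b l)⟫_ℝ = if k = l then T.singularValues k ^ 2 else 0 := by
  refine ⟨T.isSymmetric_adjoint_comp_self.eigenvectorBasis hd, fun k l => ?_⟩
  rw [← LinearMap.adjoint_inner_right, ← LinearMap.comp_apply,
    T.isSymmetric_adjoint_comp_self.apply_eigenvectorBasis hd l, inner_smul_right,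
    OrthonormalBasis.inner_eq_ite]
  split_ifs with h
  · subst h
    rw [T.sq_singularValues_fin hd]; simp
  · simp

theorem norm_apply_singular_basis {T : E →ₗ[ℝ] F} {d : ℕ} {b : OrthonormalBasis (Fin d) ℝ E}
    (hb : ∀ k l : Fin d, ⟪T (b k), T (b l)⟫_ℝ = if k = l then T.singularValues k ^ 2 else 0)
    (k : Fin d) : ‖T (b k)‖ = T.singularValues k := by
  have h := hb k k
  rw [real_inner_self_eq_norm_sq, if_pos rfl] at h
  exact (sq_eq_sq₀ (norm_nonneg _) (T.singularValues_nonneg _)).1 h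

/-- If the images of an orthonormal basis are orthogonal, norms of images are sums of squares. -/
theorem norm_sq_apply_of_orthogonal {E F : Type*} [NormedAddCommGroup E] [InnerProductSpace ℝ E]
    [NormedAddCommGroup F] [InnerProductSpace ℝ F] {T : E →ₗ[ℝ] F} {d : ℕ} (b : OrthonormalBasis (Fin d) ℝ E)
    {s : Fin d → ℝ} (hb : ∀ k l : Fin d, ⟪T (b k), T (b l)⟫_ℝ = if k = l then s k else 0) (x : E) :
    ‖T x‖ ^ 2 = ∑ k, s k * ⟪b k, x⟫_ℝ ^ 2 := by
  conv_lhs => rw [← b.sum_repr' x]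
  rw [map_sum, ← real_inner_self_eq_norm_sq, sum_inner]
  refine Finset.sum_congr rfl fun k _ => ?_
  rw [inner_sum, Finset.sum_eq_single k]
  · rw [map_smul, inner_smul_left, inner_smul_right, hb, if_pos rfl]
    simp only [conj_trivial]; ring
  · intro l _ hl
    rw [map_smul, map_smul, inner_smul_left, inner_smul_right, hb, if_neg hl.symm]; simp
  · simp

theorem norm_apply_le_singularValues_zero (T : E →ₗ[ℝ] F) (x : E) :
    ‖T x‖ ≤ T.singularValues 0 * ‖x‖ := by
  obtain ⟨b, hb⟩ := exists_singular_basis T rfl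
  refine le_of_sq_le_sq ?_ (mul_nonneg (T.singularValues_nonneg _) (norm_nonneg _))
  rw [norm_sq_apply_of_orthogonal b hb, mul_pow, ← b.sum_sq_inner_right x, Finset.mul_sum]
  gcongr with k
  · exact T.singularValues_nonneg _
  · exact T.singularValues_antitone (Nat.zero_le _)

theorem singularValues_last_mul_norm_le (T : E →ₗ[ℝ] F) (x : E) :
    T.singularValues (finrank ℝ E - 1) * ‖x‖ ≤ ‖T x‖ := by
  obtain ⟨b, hb⟩ := exists_singular_basis T rfl
  refine le_of_sq_le_sq ?_ (norm_nonneg _)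
  rw [norm_sq_apply_of_orthogonal b hb, mul_pow, ← b.sum_sq_inner_right x, Finset.mul_sum]
  gcongr with k
  · exact T.singularValues_nonneg _
  · exact T.singularValues_antitone (by omega)

/-- The sum of the singular values. -/
noncomputable def traceNorm (T : E →ₗ[ℝ] F) : ℝ :=
  ∑ k ∈ Finset.range (finrank ℝ E), T.singularValues k

theorem trace_adjoint_comp {ι : Type*} [Fintype ι] (V T : E →ₗ[ℝ] F)
    (b : OrthonormalBasis ι ℝ E) :
    LinearMap.trace ℝ E (LinearMap.adjoint V ∘ₗ T) = ∑ i, ⟪V (b i), T (b i)⟫_ℝ := by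
  rw [LinearMap.trace_eq_sum_inner _ b]
  simp [LinearMap.adjoint_inner_right]

/-- One half of the duality between trace norm and operator norm: in a basis of right singular
vectors, Cauchy–Schwarz bounds each diagonal term by a singular value. -/
theorem trace_adjoint_comp_le_traceNorm (V T : E →ₗ[ℝ] F) (hV : ∀ x, ‖V x‖ ≤ ‖x‖) :
    LinearMap.trace ℝ E (LinearMap.adjoint V ∘ₗ T) ≤ traceNorm T := by
  obtain ⟨b, hb⟩ := exists_singular_basis T rfl
  rw [trace_adjoint_comp V T b, traceNorm, Finset.sum_range]
  refine Finset.sum_le_sum fun k _ => (real_inner_le_norm _ _).trans ?_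
  rw [norm_apply_singular_basis hb]
  refine mul_le_of_le_one_left (T.singularValues_nonneg _) ((hV _).trans ?_)
  simp

theorem exists_trace_adjoint_comp_eq_traceNorm (T : E →ₗ[ℝ] F) :
    ∃ V : E →ₗ[ℝ] F, (∀ x, ‖V x‖ ≤ ‖x‖) ∧
      LinearMap.trace ℝ E (LinearMap.adjoint V ∘ₗ T) = traceNorm T := by
  obtain ⟨b, hb⟩ := exists_singular_basis T rfl
  -- The partial isometry of the polar decomposition; because 0⁻¹ = 0 it vanishes on the kernel of
  -- T.
  let V : E →ₗ[ℝ] F := b.toBasis.constr ℝ fun k => (T.singularValues k)⁻¹ • T (b k)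
  have hVb (k) : V (b k) = (T.singularValues k)⁻¹ • T (b k) := by
    simp [V]
  have horth (k l) : ⟪V (b k), V (b l)⟫_ℝ =
      if k = l then (T.singularValues k)⁻¹ ^ 2 * T.singularValues k ^ 2 else 0 := by
    rw [hVb, hVb, inner_smul_left, inner_smul_right, hb]
    split_ifs with h
    · subst h; simp only [conj_trivial]; ring
    · simp
  refine ⟨V, fun x => ?_, ?_⟩
  · refine le_of_sq_le_sq ?_ (norm_nonneg _)
    rw [norm_sq_apply_of_orthogonal b horth, ← b.sum_sq_inner_right x]
    refine Finset.sum_le_sum fun k _ => mul_le_of_le_one_left (sq_nonneg _) ?_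
    rw [← mul_pow]
    by_cases h : T.singularValues k = 0
    · simp [h]
    · rw [inv_mul_cancel₀ h]; simp
  · rw [trace_adjoint_comp V T b, traceNorm, Finset.sum_range]
    refine Finset.sum_congr rfl fun k _ => ?_
    rw [hVb, inner_smul_left, hb, if_pos rfl]
    by_cases h : T.singularValues k = 0
    · simp [h]
    · simp only [conj_trivial]; field_simp

theorem traceNorm_nonneg (T : E →ₗ[ℝ] F) : 0 ≤ traceNorm T :=
  Finset.sum_nonneg fun _ _ => T.singularValues_nonneg _

/-- By duality the trace norm is a maximum of linear functionals. -/
theorem traceNorm_add_le (S T : E →ₗ[ℝ] F) : traceNorm (S + T) ≤ traceNorm S + traceNorm T := by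
  obtain ⟨V, hV, h⟩ := exists_trace_adjoint_comp_eq_traceNorm (S + T)
  rw [← h, LinearMap.comp_add, map_add]
  exact add_le_add (trace_adjoint_comp_le_traceNorm V S hV) (trace_adjoint_comp_le_traceNorm V T hV)

theorem traceNorm_smul_le (c : ℝ) (T : E →ₗ[ℝ] F) : traceNorm (c • T) ≤ |c| * traceNorm T := by
  obtain ⟨V, hV, h⟩ := exists_trace_adjoint_comp_eq_traceNorm (c • T)
  rw [← h, LinearMap.comp_smul, map_smul, smul_eq_mul]
  rcases le_total 0 c with hc | hc
  · rw [abs_of_nonneg hc]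
    exact mul_le_mul_of_nonneg_left (trace_adjoint_comp_le_traceNorm V T hV) hc
  · rw [abs_of_nonpos hc]
    have := trace_adjoint_comp_le_traceNorm (-V) T (by simpa using hV)
    rw [map_neg, LinearMap.neg_comp, map_neg] at this
    nlinarith

/-- For T = a ⊗ c, the trace of V†T collapses to ⟪V c, a⟫. -/
theorem traceNorm_le_of_forall_rankOne {T : E →ₗ[ℝ] F} {a : F} {c : E}
    (hT : ∀ x, T x = ⟪c, x⟫_ℝ • a) : traceNorm T ≤ ‖a‖ * ‖c‖ := by
  obtain ⟨V, hV, h⟩ := exists_trace_adjoint_comp_eq_traceNorm T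
  rw [← h, trace_adjoint_comp V T (stdOrthonormalBasis ℝ E)]
  set b := stdOrthonormalBasis ℝ E
  have : ∑ i, ⟪V (b i), T (b i)⟫_ℝ = ⟪V c, a⟫_ℝ := by
    conv_rhs => rw [← b.sum_repr' c, map_sum, sum_inner]
    refine Finset.sum_congr rfl fun i _ => ?_
    rw [hT, inner_smul_right, map_smul, inner_smul_left, real_inner_comm c]; simp
  rw [this, mul_comm]
  exact (real_inner_le_norm _ _).trans (mul_le_mul_of_nonneg_right (hV c) (norm_nonneg _))

theorem norm_apply_le_traceNorm (T : E →ₗ[ℝ] F) (x : E) : ‖T x‖ ≤ traceNorm T * ‖x‖ := by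
  refine (norm_apply_le_singularValues_zero T x).trans
    (mul_le_mul_of_nonneg_right ?_ (norm_nonneg _))
  -- In dimension zero the sum is empty, so the zeroth singular value is not one of its terms and
  -- must be seen to vanish.
  by_cases h : finrank ℝ E = 0
  · rw [T.singularValues_of_finrank_le h.le]; exact traceNorm_nonneg T
  · exact Finset.single_le_sum (f := fun k => T.singularValues k)
      (fun _ _ => T.singularValues_nonneg _) (Finset.mem_range.2 (Nat.pos_of_ne_zero h))

end SingularValues

/-! ## Matrices as operators between Euclidean spaces -/

section Matrices

open scoped InnerProductSpace

theorem toEuclideanLin_apply_coord {p q : Type*} [Fintype q] [DecidableEq q]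
    (M : Matrix p q ℝ) (x : EuclideanSpace ℝ q) (i : p) :
    toEuclideanLin M x i = ∑ j, M i j * x j := rfl

theorem norm_toEuclideanLin_le {p q : Type*} [Fintype p] [Fintype q] [DecidableEq q]
    (M : Matrix p q ℝ) (x : EuclideanSpace ℝ q) : ‖toEuclideanLin M x‖ ≤ opNorm M * ‖x‖ :=
  (LinearMap.toContinuousLinearMap (toEuclideanLin M)).le_opNorm x

theorem opNorm_le_of_forall {p q : Type*} [Fintype p] [Fintype q] [DecidableEq q]
    {M : Matrix p q ℝ} {C : ℝ} (hC : 0 ≤ C)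
    (h : ∀ x, ‖toEuclideanLin M x‖ ≤ C * ‖x‖) : opNorm M ≤ C :=
  ContinuousLinearMap.opNorm_le_bound (LinearMap.toContinuousLinearMap (toEuclideanLin M)) hC h

theorem gammaMax_nonneg {p : Type*} [Fintype p] [DecidableEq p] (M : Matrix p p ℝ) :
    0 ≤ gammaMax M := LinearMap.singularValues_nonneg _ _

theorem norm_toEuclideanLin_le_gammaMax {p : Type*} [Fintype p] [DecidableEq p]
    (M : Matrix p p ℝ) (x : EuclideanSpace ℝ p) : ‖toEuclideanLin M x‖ ≤ gammaMax M * ‖x‖ :=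
  norm_apply_le_singularValues_zero _ x

theorem gammaMin_mul_norm_le {p : Type*} [Fintype p] [DecidableEq p]
    (M : Matrix p p ℝ) (x : EuclideanSpace ℝ p) : gammaMin M * ‖x‖ ≤ ‖toEuclideanLin M x‖ := by
  simpa [gammaMin, singVal] using singularValues_last_mul_norm_le (toEuclideanLin M) x

/-- A crude bound, enough to reduce the existence of a deviation constant to single entries. -/
theorem opNorm_le_sum_abs {p q : Type*} [Fintype p] [Fintype q] [DecidableEq q]
    (M : Matrix p q ℝ) : opNorm M ≤ ∑ i, ∑ j, |M i j| := by
  classical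
  refine opNorm_le_of_forall (by positivity) fun x => ?_
  have h : toEuclideanLin M x = ∑ i, ∑ j, (M i j * x j) • EuclideanSpace.single i (1 : ℝ) := by
    ext i
    rw [toEuclideanLin_apply_coord]
    simp [Pi.single_apply]
  rw [h, Finset.sum_mul]
  refine (norm_sum_le _ _).trans (Finset.sum_le_sum fun i _ => ?_)
  rw [Finset.sum_mul]
  refine (norm_sum_le _ _).trans (Finset.sum_le_sum fun j _ => ?_)
  rw [norm_smul, PiLp.norm_single, norm_one, mul_one, norm_mul, Real.norm_eq_abs]
  exact mul_le_mul_of_nonneg_left (PiLp.norm_apply_le x j) (abs_nonneg _)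

theorem nuclearNorm_eq_traceNorm {p q : Type*} [Fintype p] [Fintype q] [DecidableEq q]
    (M : Matrix p q ℝ) : nuclearNorm M = traceNorm (toEuclideanLin M) := by
  simp [nuclearNorm, traceNorm, singVal]

theorem nuclearNorm_nonneg {p q : Type*} [Fintype p] [Fintype q] [DecidableEq q]
    (M : Matrix p q ℝ) : 0 ≤ nuclearNorm M := by
  rw [nuclearNorm_eq_traceNorm]; exact traceNorm_nonneg _

theorem nuclearNorm_add_le {p q : Type*} [Fintype p] [Fintype q] [DecidableEq q]
    (M M' : Matrix p q ℝ) : nuclearNorm (M + M') ≤ nuclearNorm M + nuclearNorm M' := by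
  simp only [nuclearNorm_eq_traceNorm, map_add]; exact traceNorm_add_le _ _

theorem nuclearNorm_smul_le {p q : Type*} [Fintype p] [Fintype q] [DecidableEq q]
    (c : ℝ) (M : Matrix p q ℝ) : nuclearNorm (c • M) ≤ |c| * nuclearNorm M := by
  simp only [nuclearNorm_eq_traceNorm, map_smul]; exact traceNorm_smul_le _ _

theorem nuclearNorm_vecMulVec_le {p q : Type*} [Fintype p] [Fintype q] [DecidableEq q]
    (a : EuclideanSpace ℝ p) (c : EuclideanSpace ℝ q) :
    nuclearNorm (vecMulVec a.ofLp c.ofLp) ≤ ‖a‖ * ‖c‖ := by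
  rw [nuclearNorm_eq_traceNorm]
  refine traceNorm_le_of_forall_rankOne fun x => ?_
  ext i
  rw [toEuclideanLin_apply_coord]
  simp [vecMulVec_apply, PiLp.inner_apply, Finset.sum_mul]
  exact Finset.sum_congr rfl fun j _ => by ring

theorem abs_entry_le_nuclearNorm {p q : Type*} [Fintype p] [Fintype q] [DecidableEq q]
    (M : Matrix p q ℝ) (i : p) (j : q) : |M i j| ≤ nuclearNorm M := by
  rw [nuclearNorm_eq_traceNorm]
  have h := (PiLp.norm_apply_le (toEuclideanLin M (EuclideanSpace.single j 1)) i).trans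
    (norm_apply_le_traceNorm _ _)
  rw [toEuclideanLin_apply_coord] at h
  simpa [Pi.single_apply] using h

theorem nuclearNorm_le_sum_abs {p q : Type*} [Fintype p] [Fintype q] [DecidableEq q]
    (M : Matrix p q ℝ) : nuclearNorm M ≤ ∑ i, ∑ j, |M i j| := by
  classical
  have hsum {ι : Type _} (s : Finset ι) (f : ι → Matrix p q ℝ) :
      nuclearNorm (∑ k ∈ s, f k) ≤ ∑ k ∈ s, nuclearNorm (f k) := by
    refine Finset.le_sum_of_subadditive _ ?_ nuclearNorm_add_le _ _
    rw [nuclearNorm_eq_traceNorm, map_zero]; simp [traceNorm]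
  have hM : M = ∑ ij : p × q, M ij.1 ij.2 • vecMulVec
      (EuclideanSpace.single ij.1 (1 : ℝ)).ofLp (EuclideanSpace.single ij.2 (1 : ℝ)).ofLp := by
    ext i j
    rw [Fintype.sum_prod_type, Matrix.sum_apply, Finset.sum_eq_single i, Matrix.sum_apply,
      Finset.sum_eq_single j]
    · simp [vecMulVec_apply]
    · intro l _ hl; simp [vecMulVec_apply, hl.symm]
    · simp
    · intro l _ hl; simp [vecMulVec_apply, hl.symm, Matrix.sum_apply]
    · simp
  conv_lhs => rw [hM]
  rw [← Fintype.sum_prod_type (f := fun ij : p × q => |M ij.1 ij.2|)]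
  refine (hsum _ _).trans (Finset.sum_le_sum fun ij _ => (nuclearNorm_smul_le _ _).trans ?_)
  refine mul_le_of_le_one_right (abs_nonneg _) ((nuclearNorm_vecMulVec_le _ _).trans ?_)
  simp

/-- Subadditivity makes the nuclear norm 1-Lipschitz for the sum of absolute entries. -/
theorem continuous_nuclearNorm {p q : Type*} [Fintype p] [Fintype q] [DecidableEq q] :
    Continuous (nuclearNorm : Matrix p q ℝ → ℝ) := by
  have key (M M' : Matrix p q ℝ) : nuclearNorm M - nuclearNorm M' ≤ ∑ i, ∑ j, |(M - M') i j| := by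
    have := nuclearNorm_add_le (M - M') M'
    rw [sub_add_cancel] at this
    linarith [nuclearNorm_le_sum_abs (M - M')]
  refine continuous_iff_continuousAt.2 fun M => tendsto_iff_dist_tendsto_zero.2 ?_
  have hc : Continuous fun M' : Matrix p q ℝ => ∑ i, ∑ j, |(M' - M) i j| := by
    simp only [Matrix.sub_apply]; fun_prop
  have h0 := hc.tendsto M
  simp only [sub_self, Matrix.zero_apply, abs_zero, Finset.sum_const_zero] at h0
  refine squeeze_zero (fun _ => dist_nonneg) (fun M' => ?_) h0
  rw [Real.dist_eq, abs_le]
  have h1 := key M' M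
  have h2 := key M M'
  simp only [Matrix.sub_apply, abs_sub_comm (M _ _)] at h1 h2 ⊢
  constructor <;> linarith

end Matrices

/-! ## The regularized least-squares program -/

section Program

open scoped InnerProductSpace

variable {n m N : ℕ}

/-- Coercivity: a matrix outside the cube of half-side f(0)/λ has an entry, hence a nuclear norm,
above f(0)/λ, so its penalty alone exceeds the value at 0. A minimizer over the compact cube is
therefore global. -/
theorem exists_isSolution (X : Matrix (Fin N) (Fin n) ℝ) (Z : Matrix (Fin N) (Fin n ⊕ Fin m) ℝ)
    {lam : ℝ} (hlam : 0 < lam) : ∃ Θ, IsSolution X Z lam Θ := by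
  let f : Matrix (Fin n ⊕ Fin m) (Fin n) ℝ → ℝ := fun Θ => cost X Z Θ + lam * nuclearNorm Θ
  have hcost (Θ) : 0 ≤ cost X Z Θ := by unfold cost; positivity
  have hf : Continuous f := by
    have := continuous_nuclearNorm (p := Fin n ⊕ Fin m) (q := Fin n)
    have h2 : Continuous fun Θ => cost X Z Θ := by
      unfold cost
      simp only [Matrix.sub_apply, Matrix.mul_apply]
      fun_prop
    fun_prop
  let r : ℝ := f 0 / lam
  have hr : 0 ≤ r := div_nonneg (add_nonneg (hcost _) (mul_nonneg hlam.le (nuclearNorm_nonneg _)))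
    hlam.le
  let K : Set (Matrix (Fin n ⊕ Fin m) (Fin n) ℝ) :=
    Set.pi Set.univ fun _ => Set.pi Set.univ fun _ => Set.Icc (-r) r
  have hK : IsCompact K := isCompact_univ_pi fun _ => isCompact_univ_pi fun _ => isCompact_Icc
  have h0 : (0 : Matrix (Fin n ⊕ Fin m) (Fin n) ℝ) ∈ K := by
    intro i _ j _; simp [hr]
  obtain ⟨Θ, -, hΘ⟩ := hK.exists_isMinOn ⟨0, h0⟩ hf.continuousOn
  refine ⟨Θ, fun Θ' => ?_⟩
  by_cases h : Θ' ∈ K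
  · exact hΘ h
  · refine (hΘ h0).trans ?_
    have : r < nuclearNorm Θ' := by
      by_contra! hle
      exact h fun i _ j _ => abs_le.1 ((abs_entry_le_nuclearNorm Θ' i j).trans hle)
    have h1 : f 0 < nuclearNorm Θ' * lam := (div_lt_iff₀ hlam).1 this
    change f 0 ≤ f Θ'
    simp only [f] at h1 ⊢
    linarith [hcost Θ']

/-- First-order optimality in a rank-one direction. -/
theorem IsSolution.residual_le {X : Matrix (Fin N) (Fin n) ℝ} {Z : Matrix (Fin N) (Fin n ⊕ Fin m) ℝ}
    {lam : ℝ} (hlam : 0 ≤ lam) {Θ : Matrix (Fin n ⊕ Fin m) (Fin n) ℝ} (h : IsSolution X Z lam Θ)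
    (a : EuclideanSpace ℝ (Fin n ⊕ Fin m)) (c : EuclideanSpace ℝ (Fin n)) :
    1 / (N : ℝ) * ∑ i, ∑ j, (X - Z * Θ) i j * (Z * vecMulVec a.ofLp c.ofLp) i j
      ≤ lam * (‖a‖ * ‖c‖) := by
  set D := vecMulVec a.ofLp c.ofLp with hD
  set P := ∑ i, ∑ j, (X - Z * Θ) i j * (Z * D) i j with hP
  set Q := ∑ i, ∑ j, (Z * D) i j ^ 2 with hQ
  have hQ0 : 0 ≤ Q := by positivity
  -- Compare Θ with Θ + sD: the cost is quadratic in s and the penalty grows at most linearly;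
  -- divide by s.
  have hs (s : ℝ) (hs : 0 < s) : 1 / (N : ℝ) * P ≤ lam * (‖a‖ * ‖c‖) + s * (1 / (2 * N) * Q) := by
    have h1 := h (Θ + s • D)
    have h2 : cost X Z (Θ + s • D)
        = cost X Z Θ - s * (1 / (N : ℝ) * P) + s ^ 2 * (1 / (2 * N) * Q) := by
      have e : ∑ i, ∑ j, (X - Z * (Θ + s • D)) i j ^ 2
          = ∑ i, ∑ j, (X - Z * Θ) i j ^ 2 - 2 * s * P + s ^ 2 * Q := by
        simp only [hP, hQ, Finset.mul_sum, ← Finset.sum_sub_distrib, ← Finset.sum_add_distrib]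
        refine Finset.sum_congr rfl fun i _ => Finset.sum_congr rfl fun j _ => ?_
        rw [Matrix.mul_add, Matrix.mul_smul]
        simp only [Matrix.sub_apply, Matrix.add_apply, Matrix.smul_apply, smul_eq_mul]
        ring
      unfold cost
      rw [e]
      ring
    have h3 : nuclearNorm (Θ + s • D) ≤ nuclearNorm Θ + s * (‖a‖ * ‖c‖) := by
      refine (nuclearNorm_add_le _ _).trans (add_le_add le_rfl ((nuclearNorm_smul_le _ _).trans ?_))
      rw [abs_of_pos hs]
      exact mul_le_mul_of_nonneg_left (nuclearNorm_vecMulVec_le a c) hs.le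
    have h4 := mul_le_mul_of_nonneg_left h3 hlam
    rw [h2] at h1
    have h5 : s * (1 / (N : ℝ) * P) ≤ s * (lam * (‖a‖ * ‖c‖) + s * (1 / (2 * N) * Q)) := by
      nlinarith
    exact le_of_mul_le_mul_left h5 hs
  -- Let s tend to 0. The + 1 in the denominator below covers a vanishing quadratic term.
  refine le_of_forall_pos_le_add fun ε hε => ?_
  have hpos : 0 < 1 / (2 * (N : ℝ)) * Q + 1 := by positivity
  refine (hs (ε / (1 / (2 * (N : ℝ)) * Q + 1)) (by positivity)).trans (add_le_add le_rfl ?_)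
  rw [div_mul_eq_mul_div, div_le_iff₀ hpos]
  exact mul_le_mul_of_nonneg_left (by linarith) hε.le

theorem inner_toEuclideanLin_transpose_mul {p q : Type*} [Fintype p] [DecidableEq p] [Fintype q]
    [DecidableEq q] (Z : Matrix (Fin N) p ℝ) (W : Matrix (Fin N) q ℝ)
    (a : EuclideanSpace ℝ p) (b : EuclideanSpace ℝ q) :
    ⟪a, toEuclideanLin ((1 / (N : ℝ)) • (Zᵀ * W)) b⟫_ℝ
      = 1 / (N : ℝ) * ∑ i, toEuclideanLin Z a i * toEuclideanLin W b i := by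
  have h : toEuclideanLin ((1 / (N : ℝ)) • (Zᵀ * W)) b
      = (1 / (N : ℝ)) • toEuclideanLin Zᵀ (toEuclideanLin W b) := by
    simp only [map_smul, LinearMap.smul_apply]
    congr 1
    ext i
    simp
  rw [h, inner_smul_right, EuclideanSpace.inner_eq_star_dotProduct]
  congr 1
  have : (toEuclideanLin Zᵀ (toEuclideanLin W b)).ofLp ⬝ᵥ star a.ofLp
      = (Zᵀ *ᵥ (W *ᵥ b.ofLp)) ⬝ᵥ a.ofLp := rfl
  rw [this, Matrix.mulVec_transpose, ← Matrix.dotProduct_mulVec, dotProduct_comm]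
  rfl

theorem inner_sampleCov {p : Type*} [Fintype p] [DecidableEq p] (Z : Matrix (Fin N) p ℝ)
    (a b : EuclideanSpace ℝ p) :
    ⟪a, toEuclideanLin (sampleCov Z) b⟫_ℝ
      = 1 / (N : ℝ) * ∑ i, toEuclideanLin Z a i * toEuclideanLin Z b i :=
  inner_toEuclideanLin_transpose_mul Z Z a b

/-- The deterministic error bound for the program. -/
theorem IsSolution.opNorm_sub_le {X W : Matrix (Fin N) (Fin n) ℝ}
    {Z : Matrix (Fin N) (Fin n ⊕ Fin m) ℝ} {lam κ g : ℝ} (hlam : 0 ≤ lam) (hκ : 0 ≤ κ) (hg : 0 < g)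
    {Θ Θ₀ : Matrix (Fin n ⊕ Fin m) (Fin n) ℝ} (h : IsSolution X Z lam Θ) (hX : X = Z * Θ₀ + W)
    (hlow : ∀ x, g * ‖x‖ ≤ ‖toEuclideanLin (sampleCov Z) x‖)
    (hnoise : ∀ a c, 1 / (N : ℝ) * ∑ i, toEuclideanLin Z a i * toEuclideanLin W c i
      ≤ κ * (‖a‖ * ‖c‖)) :
    opNorm (Θ - Θ₀) ≤ (lam + κ) / g := by
  refine opNorm_le_of_forall (by positivity) fun c => ?_
  set y := toEuclideanLin (Θ - Θ₀) c with hy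
  set a := toEuclideanLin (sampleCov Z) y with ha
  -- With a = Σ̂(Θ - Θ₀)c as its own test direction, the left side becomes ‖a‖² minus the noise
  -- form; the sign of -a makes ‖a‖² enter positively.
  have h1 := h.residual_le hlam (-a) c
  have h2 := hnoise a c
  have h3 : ∑ i, ∑ j, (X - Z * Θ) i j * (Z * vecMulVec (-a).ofLp c.ofLp) i j
      = ∑ i, toEuclideanLin Z a i * toEuclideanLin Z y i
        - ∑ i, toEuclideanLin Z a i * toEuclideanLin W c i := by
    rw [← Finset.sum_sub_distrib]
    refine Finset.sum_congr rfl fun i _ => ?_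
    have e1 (j) : (Z * vecMulVec (-a).ofLp c.ofLp) i j = - toEuclideanLin Z a i * c j := by
      rw [toEuclideanLin_apply_coord, Matrix.mul_apply, ← Finset.sum_neg_distrib, Finset.sum_mul]
      refine Finset.sum_congr rfl fun k _ => ?_
      simp [vecMulVec_apply]; ring
    have e2 : toEuclideanLin Z y i - toEuclideanLin W c i
        = - ∑ j, (X - Z * Θ) i j * c j := by
      have : X - Z * Θ = W - Z * (Θ - Θ₀) := by rw [hX, Matrix.mul_sub]; abel
      rw [this, toEuclideanLin_apply_coord W, ← sub_eq_zero]
      have e3 : toEuclideanLin Z y i = ∑ j, (Z * (Θ - Θ₀)) i j * c j := by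
        have : toEuclideanLin Z y = toEuclideanLin (Z * (Θ - Θ₀)) c := by
          ext i; simp [hy]
        rw [this]; rfl
      rw [e3]
      simp only [Matrix.sub_apply, sub_mul, Finset.sum_sub_distrib]
      ring
    rw [← mul_sub, e2, mul_neg, Finset.mul_sum, ← Finset.sum_neg_distrib]
    refine Finset.sum_congr rfl fun j _ => ?_
    rw [e1]; ring
  rw [h3, mul_sub, ← inner_sampleCov, ← ha, real_inner_self_eq_norm_sq, norm_neg] at h1
  have h4 : ‖a‖ * ‖a‖ ≤ ‖a‖ * ((lam + κ) * ‖c‖) := by nlinarith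
  have h5 : ‖a‖ ≤ (lam + κ) * ‖c‖ := by
    rcases (norm_nonneg a).eq_or_lt with h0 | h0
    · rw [← h0]; positivity
    · exact le_of_mul_le_mul_left h4 h0
  rw [div_mul_eq_mul_div, le_div_iff₀ hg, mul_comm]
  exact (hlow y).trans h5

end Program

/-! ## Nets of the unit sphere -/

section Nets

open scoped InnerProductSpace
open Module

/-- The unit sphere has a `1/2`-net of at most `5 ^ dim` points. -/
theorem exists_half_net (E : Type*) [NormedAddCommGroup E] [InnerProductSpace ℝ E]
    [FiniteDimensional ℝ E] :
    ∃ s : Finset E, s.card ≤ 5 ^ finrank ℝ E ∧ (∀ x ∈ s, ‖x‖ = 1) ∧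
      ∀ y : E, ‖y‖ = 1 → ∃ x ∈ s, ‖y - x‖ ≤ 1 / 2 := by
  classical
  let Sep : Finset E → Prop := fun s =>
    (∀ x ∈ s, ‖x‖ = 1) ∧ ∀ c ∈ s, ∀ d ∈ s, c ≠ d → 1 / 2 ≤ ‖c - d‖
  have hcard (s : Finset E) (hs : Sep s) : s.card ≤ 5 ^ finrank ℝ E := by
    -- Doubling turns norm 1 and separation 1/2 into the normalization of
    -- `Besicovitch.card_le_of_separated`: norm at most 2 and separation at least 1.
    have hinj : Function.Injective fun x : E => (2 : ℝ) • x :=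
      smul_right_injective E two_ne_zero
    rw [← Finset.card_image_of_injective s hinj]
    refine Besicovitch.card_le_of_separated _ ?_ ?_
    · simp only [Finset.mem_image]
      rintro _ ⟨x, hx, rfl⟩
      rw [norm_smul, hs.1 x hx]; norm_num
    · simp only [Finset.mem_image]
      rintro _ ⟨c, hc, rfl⟩ _ ⟨d, hd, rfl⟩ hne
      have := hs.2 c hc d hd fun h => hne (by rw [h])
      rw [← smul_sub, norm_smul, Real.norm_two]; linarith
  let Q : ℕ → Prop := fun k => ∃ s, Sep s ∧ s.card = k
  have hQ0 : Q 0 := ⟨∅, by simp [Sep], rfl⟩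
  -- A separated set of maximal cardinality is a net, since an uncovered point could be added.
  obtain ⟨s, hs, hsk⟩ := Nat.findGreatest_spec (P := Q) (Nat.zero_le (5 ^ finrank ℝ E)) hQ0
  refine ⟨s, hcard s hs, hs.1, fun y hy => ?_⟩
  by_contra! hfar
  have hys : y ∉ s := fun h => by have := hfar y h; norm_num at this
  have hins : Sep (insert y s) := by
    constructor
    · intro x hx
      rcases Finset.mem_insert.1 hx with rfl | hx
      · exact hy
      · exact hs.1 x hx
    · intro c hc d hd hne
      rcases Finset.mem_insert.1 hc with rfl | hc' <;> rcases Finset.mem_insert.1 hd with rfl | hd'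
      · exact absurd rfl hne
      · exact (hfar d hd').le
      · rw [norm_sub_rev]; exact (hfar c hc').le
      · exact hs.2 c hc' d hd' hne
  have h1 : Q (s.card + 1) := ⟨_, hins, Finset.card_insert_of_notMem hys⟩
  have h2 := Nat.le_findGreatest (P := Q)
    ((Finset.card_insert_of_notMem hys).symm.le.trans (hcard _ hins)) h1
  omega

/-- Replacing the direction of y by a net point within 1/2 loses at most ‖y‖/2, which is absorbed on
the left. A one-sided hypothesis is enough. -/
theorem norm_le_two_mul_of_net {E : Type*} [NormedAddCommGroup E] [InnerProductSpace ℝ E]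
    {s : Finset E} (hs : ∀ y : E, ‖y‖ = 1 → ∃ x ∈ s, ‖y - x‖ ≤ 1 / 2) {t : ℝ} (ht : 0 ≤ t)
    {y : E} (hy : ∀ a ∈ s, ⟪a, y⟫_ℝ ≤ t) : ‖y‖ ≤ 2 * t := by
  by_cases h0 : y = 0
  · simp [h0, ht]
  have hy0 : 0 < ‖y‖ := norm_pos_iff.2 h0
  obtain ⟨a, ha, hya⟩ := hs (‖y‖⁻¹ • y) (by rw [norm_smul, norm_inv, norm_norm]; field_simp)
  have h1 := hy a ha
  have h2 : ⟪‖y‖⁻¹ • y - a, y⟫_ℝ ≤ 1 / 2 * ‖y‖ :=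
    (real_inner_le_norm _ _).trans (mul_le_mul_of_nonneg_right hya hy0.le)
  rw [inner_sub_left, real_inner_smul_left, real_inner_self_eq_norm_sq, sq, ← mul_assoc,
    inv_mul_cancel₀ hy0.ne', one_mul] at h2
  linarith

/-- Each net costs a factor 2: the net in F bounds S on the net points of E, and the net in E then
bounds the norm by 2t + ‖S‖/2, which is absorbed. -/
theorem norm_apply_le_of_nets {E F : Type*} [NormedAddCommGroup E] [InnerProductSpace ℝ E]
    [FiniteDimensional ℝ E] [NormedAddCommGroup F] [InnerProductSpace ℝ F]
    {s : Finset F} (hs : ∀ y : F, ‖y‖ = 1 → ∃ x ∈ s, ‖y - x‖ ≤ 1 / 2)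
    {r : Finset E} (hr : ∀ y : E, ‖y‖ = 1 → ∃ x ∈ r, ‖y - x‖ ≤ 1 / 2) {t : ℝ} (ht : 0 ≤ t)
    (S : E →ₗ[ℝ] F) (h : ∀ a ∈ s, ∀ c ∈ r, ⟪a, S c⟫_ℝ ≤ t) (x : E) : ‖S x‖ ≤ 4 * t * ‖x‖ := by
  have h1 (c) (hc : c ∈ r) : ‖S c‖ ≤ 2 * t := norm_le_two_mul_of_net hs ht fun a ha => h a ha c hc
  set L := LinearMap.toContinuousLinearMap S
  have h2 (y : E) (hy : ‖y‖ = 1) : ‖S y‖ ≤ 2 * t + ‖L‖ / 2 := by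
    obtain ⟨c, hc, hyc⟩ := hr y hy
    have e : S y = S c + L (y - c) := by simp [L]
    rw [e]
    refine (norm_add_le _ _).trans (add_le_add (h1 c hc) ((L.le_opNorm _).trans ?_))
    rw [div_eq_mul_one_div]
    exact mul_le_mul_of_nonneg_left hyc (norm_nonneg _)
  have h3 : ‖L‖ ≤ 2 * t + ‖L‖ / 2 := by
    refine ContinuousLinearMap.opNorm_le_bound _ (by positivity) fun y => ?_
    by_cases h0 : y = 0
    · simp [h0]
    have hy0 : 0 < ‖y‖ := norm_pos_iff.2 h0
    have := h2 (‖y‖⁻¹ • y) (by rw [norm_smul, norm_inv, norm_norm]; field_simp)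
    rw [map_smul, norm_smul, norm_inv, norm_norm, inv_mul_le_iff₀ hy0] at this
    rw [mul_comm]; exact this
  refine (L.le_opNorm x).trans (mul_le_mul_of_nonneg_right (by linarith) (norm_nonneg _))

end Nets

/-! ## Integrals over product measures -/

section Product

/-- Fubini with coordinate i integrated innermost. It replaces conditioning on the other
coordinates. -/
theorem lintegral_pi_le_of_forall_update {ι : Type*} [Fintype ι] [DecidableEq ι] {X : ι → Type*}
    [∀ i, MeasurableSpace (X i)] (μ : ∀ i, Measure (X i)) [∀ i, IsProbabilityMeasure (μ i)]
    {f : (∀ i, X i) → ℝ≥0∞} (hf : Measurable f) (i : ι) {C : ℝ≥0∞}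
    (h : ∀ x, ∫⁻ y, f (Function.update x i y) ∂μ i ≤ C) : ∫⁻ x, f x ∂Measure.pi μ ≤ C := by
  obtain ⟨x⟩ := (Measure.pi μ).nonempty_of_neZero
  have hu : (Finset.univ : Finset ι) = (Finset.univ.erase i) ∪ {i} := by
    ext j; by_cases h : j = i <;> simp [h]
  rw [lintegral_eq_lmarginal_univ x, hu, lmarginal_union _ _ hf (by simp), lmarginal_singleton]
  refine (lmarginal_mono (g := fun _ => C) h x).trans ?_
  simp [lmarginal]

theorem lintegral_pi_prod {ι : Type*} [Fintype ι] {X : Type*} [MeasurableSpace X]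
    (μ : Measure X) [IsProbabilityMeasure μ] {f : X → ℝ≥0∞} (hf : Measurable f) :
    ∫⁻ x, ∏ i : ι, f (x i) ∂Measure.pi (fun _ : ι => μ) = (∫⁻ x, f x ∂μ) ^ Fintype.card ι := by
  have h := lintegral_prod_eq_prod_lintegral_of_indepFun Finset.univ (fun i (x : ι → X) => f (x i))
    (iIndepFun_pi (μ := fun _ : ι => μ) fun _ => hf.aemeasurable)
    fun i => hf.comp (measurable_pi_apply i)
  rw [h]
  have (i : ι) : ∫⁻ x, f (x i) ∂Measure.pi (fun _ : ι => μ) = ∫⁻ x, f x ∂μ :=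
    (measurePreserving_eval (fun _ : ι => μ) i).lintegral_comp hf
  simp [this]

end Product

/-! ## Structure of a trial -/

section Trials

variable {n m T : ℕ} (A : Matrix (Fin n) (Fin n) ℝ) (B : Matrix (Fin n) (Fin m) ℝ)

theorem measurable_input (t : ℕ) : Measurable fun ξ : Trial n m T => ξ.input t := by
  unfold Trial.input
  split_ifs with h
  · fun_prop
  · fun_prop

theorem measurable_noise (t : ℕ) : Measurable fun ξ : Trial n m T => ξ.noise t := by
  unfold Trial.noise
  split_ifs with h
  · fun_prop
  · fun_prop

theorem measurable_mulVec {p q : Type*} [Fintype q] (M : Matrix p q ℝ) :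
    Measurable fun x : q → ℝ => M *ᵥ x := by
  refine measurable_pi_lambda _ fun i => ?_
  simp only [Matrix.mulVec, dotProduct]
  fun_prop

theorem measurable_state (t : ℕ) : Measurable fun ξ : Trial n m T => state A B ξ t := by
  induction t with
  | zero => exact measurable_const
  | succ t ih =>
    exact (((measurable_mulVec A).comp ih).add
      ((measurable_mulVec B).comp (measurable_input t))).add (measurable_noise t)

theorem measurable_regressor (t : ℕ) : Measurable fun ξ : Trial n m T => regressor A B ξ t := by
  refine (WithLp.measurable_toLp 2 _).comp (measurable_pi_lambda _ fun i => ?_)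
  rcases i with i | i
  · exact (measurable_pi_apply i).comp (measurable_state A B t)
  · exact (measurable_pi_apply i).comp (measurable_input t)

/-- Causality of the recursion. -/
theorem state_congr {ξ ξ' : Trial n m T} {t : ℕ} (h : ∀ s : Fin T, (s : ℕ) < t → ξ s = ξ' s) :
    state A B ξ t = state A B ξ' t := by
  induction t with
  | zero => rfl
  | succ t ih =>
    have hin : ξ.input t = ξ'.input t := by
      unfold Trial.input
      split_ifs with ht
      · rw [h ⟨t, ht⟩ (Nat.lt_succ_self t)]
      · rfl
    have hno : ξ.noise t = ξ'.noise t := by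
      unfold Trial.noise
      split_ifs with ht
      · rw [h ⟨t, ht⟩ (Nat.lt_succ_self t)]
      · rfl
    simp only [state, hin, hno, ih fun s hs => h s (hs.trans (Nat.lt_succ_self t))]

/-- Redrawing the pair (u(i), w(i)) changes z(i) only through u(i). This encodes the independence of
w(i) and z(i). -/
theorem regressor_update (ξ : Trial n m T) (i : Fin T)
    (y : EuclideanSpace ℝ (Fin m) × EuclideanSpace ℝ (Fin n)) :
    regressor A B (Function.update ξ i y) i
      = WithLp.toLp 2 (Sum.elim (state A B ξ i) y.1.ofLp) := by
  unfold regressor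
  congr 2
  · refine state_congr A B fun s hs => Function.update_of_ne (fun h => ?_) _ _
    rw [h] at hs; exact lt_irrefl _ hs
  · simp [Trial.input]

end Trials

/-! ## The noise term -/

section Noise

open scoped InnerProductSpace

variable {n m T : ℕ}

theorem IsSubGaussianLaw.lintegral_exp_le {d : ℕ} {μ : Measure (EuclideanSpace ℝ (Fin d))} {σ : ℝ}
    (h : IsSubGaussianLaw μ σ) {v : EuclideanSpace ℝ (Fin d)} (hv : ‖v‖ = 1) (c : ℝ) :
    ∫⁻ x, ENNReal.ofReal (Real.exp (c * ⟪v, x⟫_ℝ)) ∂μ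
      ≤ ENNReal.ofReal (Real.exp (c ^ 2 * σ ^ 2 / 2)) := by
  have hG := h.2.2 v hv
  rw [← ofReal_integral_eq_lintegral_ofReal (hG.integrable_exp_mul c)
    (ae_of_all _ fun _ => (Real.exp_pos _).le)]
  refine ENNReal.ofReal_le_ofReal ((hG.mgf_le c).trans (le_of_eq ?_))
  rw [Real.coe_toNNReal _ (sq_nonneg σ), mul_comm (σ ^ 2)]

variable (A : Matrix (Fin n) (Fin n) ℝ) (B : Matrix (Fin n) (Fin m) ℝ)
  {Pu : Fin T → Measure (EuclideanSpace ℝ (Fin m))}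
  {Pw : Fin T → Measure (EuclideanSpace ℝ (Fin n))}

/-- The noise `w (t)` is sub-Gaussian conditionally on the regressor `z (t)`. -/
theorem lintegral_exp_regressor_noise_le [∀ t, IsProbabilityMeasure (Pu t)]
    [∀ t, IsProbabilityMeasure (Pw t)] {σ : ℝ} (hw : ∀ t, IsSubGaussianLaw (Pw t) σ) (i : Fin T)
    (a : EuclideanSpace ℝ (Fin n ⊕ Fin m)) {b : EuclideanSpace ℝ (Fin n)} (hb : ‖b‖ = 1)
    (θ : ℝ) :
    ∫⁻ ξ, ENNReal.ofReal (Real.exp (θ * (⟪a, regressor A B ξ i⟫_ℝ * ⟪b, (ξ i).2⟫_ℝ)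
      - θ ^ 2 * σ ^ 2 / 2 * ⟪a, regressor A B ξ i⟫_ℝ ^ 2)) ∂trialLaw Pu Pw ≤ 1 := by
  have hz := measurable_regressor (T := T) A B i
  -- Freeze all times except i and integrate over w(i) with u(i) fixed: ⟪a, z(i)⟫ is then a constant
  -- c, and the subtracted term exactly compensates the sub-Gaussian bound at θc.
  refine lintegral_pi_le_of_forall_update _ (by fun_prop) i fun ξ => ?_
  rw [lintegral_prod _ ?_]
  · refine (lintegral_mono (g := fun _ => 1) fun u => ?_).trans (by simp)
    simp only [regressor_update, Function.update_self]
    set c := ⟪a, WithLp.toLp 2 (Sum.elim (state A B ξ i) u.ofLp)⟫_ℝ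
    have e (w : EuclideanSpace ℝ (Fin n)) :
        ENNReal.ofReal (Real.exp (θ * (c * ⟪b, w⟫_ℝ) - θ ^ 2 * σ ^ 2 / 2 * c ^ 2))
        = ENNReal.ofReal (Real.exp (-(θ ^ 2 * σ ^ 2 / 2 * c ^ 2)))
          * ENNReal.ofReal (Real.exp (θ * c * ⟪b, w⟫_ℝ)) := by
      rw [← ENNReal.ofReal_mul (Real.exp_pos _).le, ← Real.exp_add]
      ring_nf
    simp_rw [e]
    rw [lintegral_const_mul _ (by fun_prop)]
    refine (mul_le_mul_right ((hw i).lintegral_exp_le hb (θ * c)) _).trans (le_of_eq ?_)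
    rw [← ENNReal.ofReal_mul (Real.exp_pos _).le, ← Real.exp_add, ← ENNReal.ofReal_one,
      ← Real.exp_zero]
    congr 2
    ring
  · refine Measurable.aemeasurable ?_
    have := measurable_update ξ (a := i)
    have := hz.comp this
    fun_prop

/-- A Chernoff bound for one bilinear form of the noise. -/
theorem measure_regressor_noise_le [∀ t, IsProbabilityMeasure (Pu t)]
    [∀ t, IsProbabilityMeasure (Pw t)] {σ : ℝ} (hw : ∀ t, IsSubGaussianLaw (Pw t) σ) (i : Fin T)
    (a : EuclideanSpace ℝ (Fin n ⊕ Fin m)) {b : EuclideanSpace ℝ (Fin n)} (hb : ‖b‖ = 1)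
    (N : ℕ) {V t : ℝ} (hV : 0 < V) (ht : 0 ≤ t) :
    Measure.pi (fun _ : Fin N => trialLaw Pu Pw)
      {ξ | ∑ k, ⟪a, regressor A B (ξ k) i⟫_ℝ ^ 2 ≤ N * V ∧
        N * t ≤ ∑ k, ⟪a, regressor A B (ξ k) i⟫_ℝ * ⟪b, (ξ k i).2⟫_ℝ}
      ≤ ENNReal.ofReal (Real.exp (-(N * (t ^ 2 / (2 * σ ^ 2 * V))))) := by
  have hσ := (hw i).1
  have : IsProbabilityMeasure (trialLaw Pu Pw) := by unfold trialLaw; infer_instance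
  have hz := measurable_regressor (T := T) A B i
  -- The maximizer of θt - θ²σ²V/2.
  set θ := t / (σ ^ 2 * V) with hθ
  have hθ0 : 0 ≤ θ := by positivity
  set r := t ^ 2 / (2 * σ ^ 2 * V) with hr
  have hrθ : θ * t - θ ^ 2 * σ ^ 2 / 2 * V = r := by rw [hθ, hr]; field_simp; ring
  let φ : Trial n m T → ℝ := fun ξ => θ * (⟪a, regressor A B ξ i⟫_ℝ * ⟪b, (ξ i).2⟫_ℝ)
      - θ ^ 2 * σ ^ 2 / 2 * ⟪a, regressor A B ξ i⟫_ℝ ^ 2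
  have hφ : Measurable φ := by fun_prop
  have hint : ∫⁻ ξ, ENNReal.ofReal (Real.exp (-r)) * ENNReal.ofReal (Real.exp (φ ξ))
      ∂trialLaw Pu Pw ≤ ENNReal.ofReal (Real.exp (-r)) := by
    rw [lintegral_const_mul _ (by fun_prop)]
    exact mul_le_of_le_one_right zero_le
      (lintegral_exp_regressor_noise_le A B hw i a hb θ)
  have hrhs : ENNReal.ofReal (Real.exp (-(N * r))) = ENNReal.ofReal (Real.exp (-r)) ^ N := by
    rw [← ENNReal.ofReal_pow (Real.exp_pos _).le, ← Real.exp_nat_mul]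
    ring_nf
  rw [hrhs]
  refine le_trans ?_ (pow_le_pow_left' hint N)
  have := lintegral_pi_prod (ι := Fin N) (trialLaw Pu Pw)
    (f := fun ξ => ENNReal.ofReal (Real.exp (-r)) * ENNReal.ofReal (Real.exp (φ ξ))) (by fun_prop)
  rw [Fintype.card_fin] at this
  rw [← this]
  -- Markov's inequality: on the event, the bound on the sum of squares makes the compensator
  -- deterministic, so the product of exponentials is at least 1.
  refine meas_le_lintegral₀ ?_ ?_
  · refine Measurable.aemeasurable (Finset.measurable_fun_prod _ fun k _ => ?_)
    have : Measurable fun ξ : Fin N → Trial n m T => φ (ξ k) := hφ.comp (measurable_pi_apply k)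
    fun_prop
  · rintro ξ ⟨h1, h2⟩
    have e (k : Fin N) : ENNReal.ofReal (Real.exp (-r)) * ENNReal.ofReal (Real.exp (φ (ξ k)))
        = ENNReal.ofReal (Real.exp (φ (ξ k) - r)) := by
      rw [← ENNReal.ofReal_mul (Real.exp_pos _).le, ← Real.exp_add]; ring_nf
    simp_rw [e]
    rw [← ENNReal.ofReal_prod_of_nonneg fun _ _ => (Real.exp_pos _).le, ← Real.exp_sum,
      ENNReal.one_le_ofReal, Real.one_le_exp_iff]
    simp only [φ, Finset.sum_sub_distrib, ← Finset.mul_sum, Finset.sum_const, Finset.card_univ,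
      Fintype.card_fin, nsmul_eq_mul]
    have h3 := mul_le_mul_of_nonneg_left h1 (show 0 ≤ θ ^ 2 * σ ^ 2 / 2 by positivity)
    have h4 := mul_le_mul_of_nonneg_left h2 hθ0
    rw [← hrθ]
    nlinarith

end Noise

/-! ## Consequences of the deviation bound -/

section Deviation

open scoped InnerProductSpace

theorem toEuclideanLin_sub_apply {p q : Type*} [Fintype q] [DecidableEq q] (M M' : Matrix p q ℝ)
    (x : EuclideanSpace ℝ q) :
    toEuclideanLin (M - M') x = toEuclideanLin M x - toEuclideanLin M' x := by
  rw [map_sub, LinearMap.sub_apply]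

/-- With fewer samples than dimensions, the sample covariance matrix is singular. -/
theorem gammaMin_le_opNorm_sampleCov_sub {p : Type*} [Fintype p] [DecidableEq p] {N : ℕ}
    (hN : N < Fintype.card p) (Z : Matrix (Fin N) p ℝ) (S : Matrix p p ℝ) :
    gammaMin S ≤ opNorm (sampleCov Z - S) := by
  have hker : LinearMap.ker (toEuclideanLin Z) ≠ ⊥ :=
    LinearMap.ker_ne_bot_of_finrank_lt (by simpa using hN)
  obtain ⟨v, hv, hv0⟩ := (Submodule.ne_bot_iff _).1 hker
  have hv1 : toEuclideanLin (sampleCov Z) v = 0 := by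
    rw [← inner_self_eq_zero (𝕜 := ℝ), inner_sampleCov, LinearMap.mem_ker.1 hv]
    simp
  have h1 := norm_toEuclideanLin_le (sampleCov Z - S) v
  rw [toEuclideanLin_sub_apply, hv1, zero_sub, norm_neg] at h1
  exact le_of_mul_le_mul_right ((gammaMin_mul_norm_le S v).trans h1) (norm_pos_iff.2 hv0)

/-- Test the deviation bound on d - 1 samples with δ = 1. The sample covariance is singular, so the
deviation is always at least γ_min; were γ_min this large, the event would be certain, while its
bound is below 1. Here d/(d - 1) ≤ 2 makes the bracket at most 4, whence 64 = 16 · 4. -/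
theorem IsDeviationConstant.gammaMin_lt {p : Type*} [Fintype p] [DecidableEq p]
    {ρ : Measure (EuclideanSpace ℝ p)} [IsProbabilityMeasure ρ] {β : ℝ}
    (h : IsDeviationConstant ρ β) (hp : 2 ≤ Fintype.card p) :
    gammaMin (covMatrix ρ) < (64 * √6 + 1) * β ^ 2 := by
  by_contra! hle
  obtain ⟨k, hk⟩ : ∃ k, Fintype.card p = k + 1 := ⟨Fintype.card p - 1, by omega⟩
  have hk1 : (1 : ℝ) ≤ k := by exact_mod_cast (by omega : 1 ≤ k)
  have h1 := h.2 k (by omega) 1 one_pos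
  have hratio : (Fintype.card p : ℝ) / k ≤ 2 := by
    rw [hk, div_le_iff₀ (by linarith)]; push_cast; linarith
  have hsqrt : √((Fintype.card p : ℝ) / k) ≤ 2 := by
    rw [Real.sqrt_le_left (by norm_num)]; linarith
  have huniv : {Z : Fin k → EuclideanSpace ℝ p | 16 * √6 * β ^ 2 *
      (√((Fintype.card p : ℝ) / k) + (Fintype.card p : ℝ) / k) + 1 * β ^ 2
      ≤ opNorm (sampleCov (Matrix.of fun i j => Z i j) - covMatrix ρ)} = Set.univ := by
    refine Set.eq_univ_of_forall fun Z => ?_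
    refine le_trans ?_ (hle.trans (gammaMin_le_opNorm_sampleCov_sub (by omega) _ _))
    have : 16 * √6 * β ^ 2 * (√((Fintype.card p : ℝ) / k) + (Fintype.card p : ℝ) / k)
        ≤ 16 * √6 * β ^ 2 * 4 := by gcongr; linarith
    linarith
  rw [huniv, measure_univ, ENNReal.one_le_ofReal, Real.one_le_exp_iff] at h1
  have : 0 < (k : ℝ) * min (1 / (16 * √2)) (1 ^ 2 / 512) :=
    mul_pos (by linarith) (lt_min (by positivity) (by positivity))
  linarith

/-- Take δ = √(d/N) ≤ 1: then d/N ≤ δ merges all terms of the threshold, and the quadratic branch of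
the exponent yields Nδ²/512 = d/512. -/
theorem IsDeviationConstant.measure_le {p : Type*} [Fintype p] [DecidableEq p]
    {ρ : Measure (EuclideanSpace ℝ p)} {β : ℝ} (h : IsDeviationConstant ρ β) {N : ℕ} (hN : 1 ≤ N)
    (hp : 1 ≤ Fintype.card p) (hpN : (Fintype.card p : ℝ) ≤ N) :
    Measure.pi (fun _ : Fin N => ρ)
      {Z | (32 * √6 + 1) * β ^ 2 * √((Fintype.card p : ℝ) / N)
          ≤ opNorm (sampleCov (Matrix.of fun i j => Z i j) - covMatrix ρ)}
      ≤ ENNReal.ofReal (Real.exp (-((Fintype.card p : ℝ) / 512))) := by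
  set d : ℝ := (Fintype.card p : ℝ) with hd
  have hd1 : 1 ≤ d := Nat.one_le_cast.2 hp
  have hN0 : (0 : ℝ) < N := by exact_mod_cast hN
  have hr0 : 0 < d / N := by positivity
  have hr1 : d / N ≤ 1 := (div_le_one hN0).2 hpN
  set δ := √(d / N) with hδ
  have hδ0 : 0 < δ := Real.sqrt_pos.2 hr0
  have hδsq : δ ^ 2 = d / N := Real.sq_sqrt hr0.le
  have hδ1 : δ ≤ 1 := Real.sqrt_le_one.2 hr1
  have hle : d / N ≤ δ := by rw [← hδsq]; nlinarith
  refine (measure_mono fun Z hZ => ?_).trans ((h.2 N hN δ hδ0).trans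
    (ENNReal.ofReal_le_ofReal (Real.exp_le_exp.2 (neg_le_neg ?_))))
  · refine le_trans ?_ hZ.out
    have : 16 * √6 * β ^ 2 * (δ + d / N) ≤ 16 * √6 * β ^ 2 * (δ + δ) := by gcongr
    rw [← hd, ← hδ]
    linarith
  · have h2 : 16 * √2 ≤ 512 := by
      have : √2 ≤ 2 := by rw [Real.sqrt_le_left (by norm_num)]; norm_num
      linarith
    have h3 : δ ^ 2 / 512 ≤ min (δ / (16 * √2)) (δ ^ 2 / 512) := by
      refine le_min ?_ le_rfl
      have : δ ^ 2 ≤ δ := by nlinarith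
      gcongr
    calc d / 512 = N * (δ ^ 2 / 512) := by rw [hδsq]; field_simp
      _ ≤ _ := mul_le_mul_of_nonneg_left h3 hN0.le

end Deviation

/-! ## The error bound in terms of the deviation constant -/

section ErrorBound

open scoped InnerProductSpace

variable {n m T : ℕ} (A : Matrix (Fin n) (Fin n) ℝ) (B : Matrix (Fin n) (Fin m) ℝ)

/-- The matrix with rows `w⁽ⁱ⁾ (t)`. -/
def noiseMatrix {N : ℕ} (ξ : Fin N → Trial n m T) (t : Fin T) : Matrix (Fin N) (Fin n) ℝ :=
  Matrix.of fun i j => (ξ i t).2 j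

theorem responseMatrix_eq {N : ℕ} (hT : 1 ≤ T) (ξ : Fin N → Trial n m T) :
    responseMatrix A B ξ = measurementMatrix A B ξ * theta A B
      + noiseMatrix ξ ⟨T - 1, Nat.sub_lt hT one_pos⟩ := by
  obtain ⟨k, rfl⟩ : ∃ k, T = k + 1 := ⟨T - 1, by omega⟩
  ext i j
  simp only [responseMatrix, noiseMatrix, Matrix.add_apply, Matrix.of_apply, Matrix.mul_apply,
    state, Pi.add_apply, Fintype.sum_sum_type, theta, measurementMatrix, regressor]
  simp [Matrix.mulVec, dotProduct, Trial.noise, mul_comm]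

theorem toEuclideanLin_measurementMatrix {N : ℕ} (ξ : Fin N → Trial n m T)
    (a : EuclideanSpace ℝ (Fin n ⊕ Fin m)) (k : Fin N) :
    toEuclideanLin (measurementMatrix A B ξ) a k = ⟪a, regressor A B (ξ k) (T - 1)⟫_ℝ := by
  rw [toEuclideanLin_apply_coord, PiLp.inner_apply]; rfl

theorem toEuclideanLin_noiseMatrix {N : ℕ} (ξ : Fin N → Trial n m T) (t : Fin T)
    (b : EuclideanSpace ℝ (Fin n)) (k : Fin N) :
    toEuclideanLin (noiseMatrix ξ t) b k = ⟪b, (ξ k t).2⟫_ℝ := by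
  rw [toEuclideanLin_apply_coord, PiLp.inner_apply]; rfl

variable {A B}
variable {Pu : Fin T → Measure (EuclideanSpace ℝ (Fin m))}
  {Pw : Fin T → Measure (EuclideanSpace ℝ (Fin n))}

theorem isProbabilityMeasure_trialLaw [∀ t, IsProbabilityMeasure (Pu t)]
    [∀ t, IsProbabilityMeasure (Pw t)] : IsProbabilityMeasure (trialLaw Pu Pw) := by
  unfold trialLaw; infer_instance

theorem isProbabilityMeasure_rowLaw [∀ t, IsProbabilityMeasure (Pu t)]
    [∀ t, IsProbabilityMeasure (Pw t)] : IsProbabilityMeasure (rowLaw A B Pu Pw) :=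
  have := isProbabilityMeasure_trialLaw (Pu := Pu) (Pw := Pw)
  Measure.isProbabilityMeasure_map (measurable_regressor A B _).aemeasurable

/-- The sample covariance matrix of the trials obeys the deviation bound. -/
theorem measure_sampleCov_measurementMatrix_le [∀ t, IsProbabilityMeasure (Pu t)]
    [∀ t, IsProbabilityMeasure (Pw t)] (N : ℕ) (r : ℝ) :
    Measure.pi (fun _ : Fin N => trialLaw Pu Pw)
      {ξ | r ≤ opNorm (sampleCov (measurementMatrix A B ξ) - covMatrix (rowLaw A B Pu Pw))}
    ≤ Measure.pi (fun _ : Fin N => rowLaw A B Pu Pw)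
      {Z | r ≤ opNorm (sampleCov (Matrix.of fun i j => Z i j)
        - covMatrix (rowLaw A B Pu Pw))} := by
  have := isProbabilityMeasure_trialLaw (Pu := Pu) (Pw := Pw)
  have hrow := isProbabilityMeasure_rowLaw (A := A) (B := B) (Pu := Pu) (Pw := Pw)
  have hm := measurable_regressor (T := T) A B (T - 1)
  have : ∀ _ : Fin N, SigmaFinite ((trialLaw Pu Pw).map fun ξ => regressor A B ξ (T - 1)) :=
    fun _ => by change SigmaFinite (rowLaw A B Pu Pw); infer_instance
  have h := Measure.pi_map_pi (μ := fun _ : Fin N => trialLaw Pu Pw)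
    (f := fun _ ξ => regressor A B ξ (T - 1)) fun _ => hm.aemeasurable
  unfold rowLaw at *
  rw [← h]
  exact Measure.le_map_apply (f := fun (ξ : Fin N → Trial n m T) i => regressor A B (ξ i) (T - 1))
    (measurable_pi_lambda _ fun i => hm.comp (measurable_pi_apply i)).aemeasurable _

/-- The union bound over pairs of net points is affordable because 25e⁻⁴ ≤ e^(-1/512). -/
theorem pow_net_mul_exp_le {n m : ℕ} :
    (5 : ℝ) ^ (n + m) * 5 ^ n * Real.exp (-(4 * ((n : ℝ) + m)))
      ≤ Real.exp (-(((n : ℝ) + m) / 512)) := by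
  have h1 : (5 : ℝ) ^ n ≤ 5 ^ (n + m) := pow_le_pow_right₀ (by norm_num) (by omega)
  have h4 : Real.exp (-4) ≤ 1 / 50 := by
    rw [Real.exp_neg, ← one_div]
    refine one_div_le_one_div_of_le (by norm_num) ?_
    have : Real.exp 4 = Real.exp 1 ^ 4 := by rw [← Real.exp_nat_mul]; norm_num
    rw [this]
    have h := Real.exp_one_gt_d9
    calc (50 : ℝ) ≤ 2.7 ^ 4 := by norm_num
      _ ≤ _ := by gcongr; linarith
  have h5 : 25 * Real.exp (-4) ≤ Real.exp (-(1 / 512)) := by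
    have := Real.add_one_le_exp (-(1 / 512 : ℝ))
    linarith
  have e1 : Real.exp (-(4 * ((n : ℝ) + m))) = Real.exp (-4) ^ (n + m) := by
    rw [← Real.exp_nat_mul]; push_cast; ring_nf
  have e2 : Real.exp (-(((n : ℝ) + m) / 512)) = Real.exp (-(1 / 512)) ^ (n + m) := by
    rw [← Real.exp_nat_mul]; push_cast; ring_nf
  rw [e1, e2]
  calc (5 : ℝ) ^ (n + m) * 5 ^ n * Real.exp (-4) ^ (n + m)
      ≤ (5 : ℝ) ^ (n + m) * 5 ^ (n + m) * Real.exp (-4) ^ (n + m) := by gcongr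
    _ = (25 * Real.exp (-4)) ^ (n + m) := by rw [← mul_pow, ← mul_pow]; norm_num
    _ ≤ _ := by gcongr

/-- The event on which the noise matrix is well aligned with no direction of the measurements, up
to samples with a large sample covariance matrix. -/
theorem measure_exists_noise_ge_le [∀ t, IsProbabilityMeasure (Pu t)]
    [∀ t, IsProbabilityMeasure (Pw t)] {σ : ℝ} (hw : ∀ t, IsSubGaussianLaw (Pw t) σ) (hT : 1 ≤ T)
    {N : ℕ} (hN : 1 ≤ N) {V : ℝ} (hV : 0 < V) :
    Measure.pi (fun _ : Fin N => trialLaw Pu Pw)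
      {ξ | opNorm (sampleCov (measurementMatrix A B ξ)) ≤ V ∧
        ¬ ∀ x, ‖toEuclideanLin ((1 / (N : ℝ)) • ((measurementMatrix A B ξ)ᵀ *
          noiseMatrix ξ ⟨T - 1, Nat.sub_lt hT one_pos⟩)) x‖
          ≤ 8 * √(2 * σ ^ 2 * V) * √(((n : ℝ) + m) / N) * ‖x‖}
      ≤ ENNReal.ofReal (Real.exp (-(((n : ℝ) + m) / 512))) := by
  obtain ⟨s, hs, hs1, hsnet⟩ := exists_half_net (EuclideanSpace ℝ (Fin n ⊕ Fin m))
  obtain ⟨r, hr, hr1, hrnet⟩ := exists_half_net (EuclideanSpace ℝ (Fin n))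
  set i : Fin T := ⟨T - 1, Nat.sub_lt hT one_pos⟩ with hi
  set μ := Measure.pi (fun _ : Fin N => trialLaw Pu Pw)
  have hσ := (hw i).1
  have hN0 : (0 : ℝ) < N := by exact_mod_cast hN
  -- Chosen so that the Chernoff exponent is 4(n + m); the two nets turn t into 4t, which gives the
  -- factor 8.
  set t := 2 * √(2 * σ ^ 2 * V) * √(((n : ℝ) + m) / N) with ht
  have ht0 : 0 ≤ t := by positivity
  have hexp : N * (t ^ 2 / (2 * σ ^ 2 * V)) = 4 * ((n : ℝ) + m) := by
    rw [ht, mul_pow, mul_pow, Real.sq_sqrt (by positivity), Real.sq_sqrt (by positivity)]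
    field_simp; ring
  let E : EuclideanSpace ℝ (Fin n ⊕ Fin m) × EuclideanSpace ℝ (Fin n) →
      Set (Fin N → Trial n m T) := fun ab =>
    {ξ | ∑ k, ⟪ab.1, regressor A B (ξ k) i⟫_ℝ ^ 2 ≤ N * V ∧
        N * t ≤ ∑ k, ⟪ab.1, regressor A B (ξ k) i⟫_ℝ * ⟪ab.2, (ξ k i).2⟫_ℝ}
  have hE (ab) (hab : ab ∈ s ×ˢ r) : μ (E ab) ≤ ENNReal.ofReal (Real.exp (-(4 * ((n : ℝ) + m)))) := by
    rw [← hexp]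
    exact measure_regressor_noise_le A B hw i ab.1 (hr1 _ (Finset.mem_product.1 hab).2) N hV ht0
  refine (measure_mono (t := ⋃ ab ∈ s ×ˢ r, E ab) ?_).trans
    ((measure_biUnion_finset_le _ _).trans ((Finset.sum_le_sum hE).trans ?_))
  · rintro ξ ⟨h1, h2⟩
    by_contra h3
    refine h2 fun x => ?_
    have h4 := norm_apply_le_of_nets hsnet hrnet ht0 (toEuclideanLin ((1 / (N : ℝ)) •
      ((measurementMatrix A B ξ)ᵀ * noiseMatrix ξ i))) (fun a ha c hc => ?_) x
    · refine h4.trans (le_of_eq ?_)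
      rw [ht]; ring
    · rw [inner_toEuclideanLin_transpose_mul]
      simp only [toEuclideanLin_measurementMatrix, toEuclideanLin_noiseMatrix]
      have h5 : ξ ∉ E (a, c) := fun h =>
        h3 (Set.mem_biUnion (Finset.mem_coe.2 (Finset.mk_mem_product ha hc)) h)
      -- The truncation in E is automatic here: for a unit vector the quadratic form of Σ̂ is at
      -- most ‖Σ̂‖ ≤ V.
      have h6 : ∑ k, ⟪a, regressor A B (ξ k) i⟫_ℝ ^ 2 ≤ N * V := by
        have h7 := (real_inner_le_norm a (toEuclideanLin (sampleCov (measurementMatrix A B ξ)) a))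
        have h8 := norm_toEuclideanLin_le (sampleCov (measurementMatrix A B ξ)) a
        rw [inner_sampleCov] at h7
        simp only [toEuclideanLin_measurementMatrix] at h7
        rw [hs1 a ha] at h7 h8
        have h9 : 1 / (N : ℝ) * ∑ k, ⟪a, regressor A B (ξ k) (T - 1)⟫_ℝ
            * ⟪a, regressor A B (ξ k) (T - 1)⟫_ℝ ≤ V := by linarith
        rw [one_div, inv_mul_le_iff₀ hN0] at h9
        simpa only [sq] using h9
      have h10 : ¬ (N * t ≤ ∑ k, ⟪a, regressor A B (ξ k) i⟫_ℝ * ⟪c, (ξ k i).2⟫_ℝ) :=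
        fun h => h5 ⟨h6, h⟩
      rw [one_div, inv_mul_le_iff₀ hN0]
      exact (not_le.1 h10).le
  · rw [Finset.sum_const, nsmul_eq_mul, Finset.card_product]
    rw [← ENNReal.ofReal_natCast, ← ENNReal.ofReal_mul (by positivity)]
    refine ENNReal.ofReal_le_ofReal (le_trans ?_ (pow_net_mul_exp_le (n := n) (m := m)))
    refine mul_le_mul_of_nonneg_right ?_ (Real.exp_pos _).le
    have hs' : (s.card : ℝ) ≤ 5 ^ (n + m) := by
      have : s.card ≤ 5 ^ (n + m) := by simpa using hs
      exact_mod_cast this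
    have hr' : (r.card : ℝ) ≤ 5 ^ n := by
      have : r.card ≤ 5 ^ n := by simpa using hr
      exact_mod_cast this
    push_cast
    gcongr

/-- The assertion of the error bound for one sample of trials. -/
def ErrorBound {N : ℕ} (A : Matrix (Fin n) (Fin n) ℝ) (B : Matrix (Fin n) (Fin m) ℝ)
    (σw β : ℝ) (S : Matrix (Fin n ⊕ Fin m) (Fin n ⊕ Fin m) ℝ) (ξ : Fin N → Trial n m T) : Prop :=
  (∃ Θhat, IsSolution (responseMatrix A B ξ) (measurementMatrix A B ξ)
    (4 * alpha σw β S * √(((n : ℝ) + m) / N)) Θhat) ∧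
  ∀ Θhat, IsSolution (responseMatrix A B ξ) (measurementMatrix A B ξ)
    (4 * alpha σw β S * √(((n : ℝ) + m) / N)) Θhat →
      opNorm (Θhat - theta A B) ≤ 24 * alpha σw β S / gammaMin S * √(((n : ℝ) + m) / N)

/-- The triangle inequality gives Σ̂ the lower bound γ_min/2, and (4 + 8)/(1/2) = 24. -/
theorem errorBound_of_opNorm_le {N : ℕ} (hn : 1 ≤ n) (hT : 1 ≤ T) (hN : 1 ≤ N) {σw β : ℝ}
    (hσ : 0 < σw) (hβ : 0 < β) {S : Matrix (Fin n ⊕ Fin m) (Fin n ⊕ Fin m) ℝ}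
    (hS : 0 < gammaMin S) {ξ : Fin N → Trial n m T}
    (hcov : opNorm (sampleCov (measurementMatrix A B ξ) - S) ≤ gammaMin S / 2)
    (hnoise : ∀ x, ‖toEuclideanLin ((1 / (N : ℝ)) • ((measurementMatrix A B ξ)ᵀ *
          noiseMatrix ξ ⟨T - 1, Nat.sub_lt hT one_pos⟩)) x‖
          ≤ 8 * alpha σw β S * √(((n : ℝ) + m) / N) * ‖x‖) :
    ErrorBound A B σw β S ξ := by
  have hα : 0 < alpha σw β S := by
    have := gammaMax_nonneg S
    unfold alpha; positivity
  have hn0 : (0 : ℝ) < n := by exact_mod_cast hn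
  have hN0 : (0 : ℝ) < N := by exact_mod_cast hN
  have hr : 0 < √(((n : ℝ) + m) / N) := by positivity
  refine ⟨exists_isSolution _ _ (by positivity), fun Θ hΘ => ?_⟩
  refine (hΘ.opNorm_sub_le (κ := 8 * alpha σw β S * √(((n : ℝ) + m) / N)) (by positivity)
    (by positivity) (half_pos hS) (responseMatrix_eq A B hT ξ) (fun x => ?_)
    (fun a c => ?_)).trans (le_of_eq ?_)
  · have h1 := norm_toEuclideanLin_le (sampleCov (measurementMatrix A B ξ) - S) x
    rw [toEuclideanLin_sub_apply] at h1
    have h2 := gammaMin_mul_norm_le S x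
    have h3 := norm_sub_norm_le (toEuclideanLin S x)
      (toEuclideanLin (sampleCov (measurementMatrix A B ξ)) x)
    rw [norm_sub_rev] at h3
    have h4 := mul_le_mul_of_nonneg_right hcov (norm_nonneg x)
    linarith
  · rw [← inner_toEuclideanLin_transpose_mul]
    refine (real_inner_le_norm _ _).trans ?_
    have := mul_le_mul_of_nonneg_left (hnoise c) (norm_nonneg a)
    linarith
  · field_simp; ring

theorem measure_not_errorBound_le [∀ t, IsProbabilityMeasure (Pu t)]
    [∀ t, IsProbabilityMeasure (Pw t)] {σw β : ℝ} (hw : ∀ t, IsSubGaussianLaw (Pw t) σw)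
    (hn : 1 ≤ n) (hT : 1 ≤ T) (hS : 0 < gammaMin (covMatrix (rowLaw A B Pu Pw)))
    (hβ : IsDeviationConstant (rowLaw A B Pu Pw) β) {N : ℕ}
    (hN : (64 * √6 + 2) ^ 2 * β ^ 4 / gammaMin (covMatrix (rowLaw A B Pu Pw)) ^ 2
      * ((n : ℝ) + m) ≤ N) :
    Measure.pi (fun _ : Fin N => trialLaw Pu Pw)
      {ξ | ¬ ErrorBound A B σw β (covMatrix (rowLaw A B Pu Pw)) ξ}
      ≤ ENNReal.ofReal (2 * Real.exp (-(1 / 512) * ((n : ℝ) + m))) := by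
  have := isProbabilityMeasure_trialLaw (Pu := Pu) (Pw := Pw)
  have := isProbabilityMeasure_rowLaw (A := A) (B := B) (Pu := Pu) (Pw := Pw)
  have hβ0 := hβ.1
  have hσ := (hw ⟨0, hT⟩).1
  have hn0 : (1 : ℝ) ≤ n := by exact_mod_cast hn
  set S := covMatrix (rowLaw A B Pu Pw) with hSdef
  set d : ℝ := (n : ℝ) + m with hd
  have hd1 : 1 ≤ d := by have : (0 : ℝ) ≤ m := Nat.cast_nonneg _; linarith
  have hcard : (Fintype.card (Fin n ⊕ Fin m) : ℝ) = d := by simp [hd]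
  have hNpos : (0 : ℝ) < N := lt_of_lt_of_le (by positivity) hN
  have hN1 : 1 ≤ N := by exact_mod_cast hNpos
  -- In dimension 1 the bound 2e^(-d/512) is at least 1, so nothing is to be shown; `gammaMin_lt`
  -- needs dimension at least 2.
  by_cases hd2 : n + m < 2
  · refine prob_le_one.trans ?_
    have hd' : d ≤ 1 := by
      have : n + m ≤ 1 := by omega
      rw [hd]; exact_mod_cast this
    have := Real.add_one_le_exp (-(1 / 512) * d)
    rw [ENNReal.one_le_ofReal]
    linarith
  have hγ := hβ.gammaMin_lt (by simp; omega)
  rw [← hSdef] at hγ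
  -- As γ_min < (64√6 + 2)β², the factor in front of d in the sample size condition is at least 1.
  have hNd : d ≤ N := by
    refine le_trans (le_mul_of_one_le_left (by linarith) ?_) hN
    rw [one_le_div (by positivity)]
    have : gammaMin S ≤ (64 * √6 + 2) * β ^ 2 := by nlinarith
    calc gammaMin S ^ 2 ≤ ((64 * √6 + 2) * β ^ 2) ^ 2 := by gcongr
      _ = _ := by ring
  have hr1 : √(d / N) ≤ 1 := Real.sqrt_le_one.2 ((div_le_one hNpos).2 hNd)
  -- This fixes c₁: 64√6 + 2 is twice 32√6 + 1.
  have hκ : (32 * √6 + 1) * β ^ 2 * √(d / N) ≤ gammaMin S / 2 := by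
    have h1 : ((64 * √6 + 2) * β ^ 2 * √(d / N)) ^ 2 ≤ gammaMin S ^ 2 := by
      rw [mul_pow, Real.sq_sqrt (by positivity), mul_div_assoc', div_le_iff₀ hNpos]
      rw [div_mul_eq_mul_div, div_le_iff₀ (by positivity)] at hN
      calc _ = (64 * √6 + 2) ^ 2 * β ^ 4 * d := by ring
        _ ≤ N * gammaMin S ^ 2 := hN
        _ = _ := mul_comm _ _
    have h2 := le_of_sq_le_sq h1 hS.le
    linarith
  -- This quantity bounds ‖Σ̂‖ because √(d/N) ≤ 1, and it is the bracket in `alpha`, so the noise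
  -- bound comes out in terms of α.
  have hV : 0 < (32 * √6 + 1) * β ^ 2 + gammaMax S := by
    have := gammaMax_nonneg S
    positivity
  have hdev := (measure_sampleCov_measurementMatrix_le (A := A) (B := B) (Pu := Pu) (Pw := Pw) N
    ((32 * √6 + 1) * β ^ 2 * √((Fintype.card (Fin n ⊕ Fin m) : ℝ) / N))).trans
    (hβ.measure_le hN1 (by simp; omega) (by rw [hcard]; exact hNd))
  have hnoise := measure_exists_noise_ge_le (A := A) (B := B) (Pu := Pu) hw hT hN1 hV
  rw [hcard] at hdev
  have hsum : ENNReal.ofReal (2 * Real.exp (-(1 / 512) * d))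
      = ENNReal.ofReal (Real.exp (-(d / 512))) + ENNReal.ofReal (Real.exp (-(d / 512))) := by
    rw [← ENNReal.ofReal_add (Real.exp_pos _).le (Real.exp_pos _).le, ← two_mul]
    ring_nf
  rw [hsum]
  refine (measure_mono ?_).trans ((measure_union_le _ _).trans (add_le_add hdev hnoise))
  intro ξ hξ
  by_contra h
  rw [Set.mem_union, not_or] at h
  have h1 : opNorm (sampleCov (measurementMatrix A B ξ) - S) ≤ (32 * √6 + 1) * β ^ 2 * √(d / N) :=
    le_of_not_ge h.1
  have h2 : opNorm (sampleCov (measurementMatrix A B ξ)) ≤ (32 * √6 + 1) * β ^ 2 + gammaMax S := by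
    refine opNorm_le_of_forall hV.le fun x => ?_
    have h3 := norm_toEuclideanLin_le (sampleCov (measurementMatrix A B ξ) - S) x
    rw [toEuclideanLin_sub_apply] at h3
    have h4 := norm_toEuclideanLin_le_gammaMax S x
    have h5 := norm_sub_norm_le (toEuclideanLin (sampleCov (measurementMatrix A B ξ)) x)
      (toEuclideanLin S x)
    have h6 : opNorm (sampleCov (measurementMatrix A B ξ) - S) ≤ (32 * √6 + 1) * β ^ 2 :=
      h1.trans (mul_le_of_le_one_right (by positivity) hr1)
    have h7 := mul_le_mul_of_nonneg_right h6 (norm_nonneg x)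
    linarith
  refine hξ (errorBound_of_opNorm_le hn hT hN1 hσ hβ0 hS (h1.trans hκ) ?_)
  by_contra h3
  exact h.2 ⟨h2, h3⟩

end ErrorBound

/-! ## Sub-Gaussian and sub-exponential random variables -/

section SubExponential

variable {Ω : Type*} [MeasurableSpace Ω] {μ : Measure Ω} [IsProbabilityMeasure μ]

/-- exp(ct²/2) - mgf(t) is nonnegative and vanishes at 0, so its derivative there, minus the mean,
is 0. Centering of the regressor thus needs no separate computation. -/
theorem integral_eq_zero_of_hasSubgaussianMGF {X : Ω → ℝ} {c : NNReal}
    (h : HasSubgaussianMGF X c μ) : ∫ ω, X ω ∂μ = 0 := by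
  have hint : (0 : ℝ) ∈ interior (integrableExpSet X μ) := by simp [h.integrableExpSet_eq_univ]
  have hmin : IsLocalMin (fun t => Real.exp (c * t ^ 2 / 2) - mgf X μ t) 0 := by
    refine Filter.Eventually.of_forall fun t => ?_
    simpa using h.mgf_le t
  have hd : HasDerivAt (fun t : ℝ => Real.exp (c * t ^ 2 / 2) - mgf X μ t)
      (0 - ∫ ω, X ω ∂μ) 0 := by
    refine HasDerivAt.sub ?_ ?_
    · have h1 : HasDerivAt (fun t : ℝ => (c : ℝ) * t ^ 2 / 2) 0 0 := by
        simpa using (((hasDerivAt_id (0 : ℝ)).pow 2).const_mul (c : ℝ)).div_const 2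
      simpa using h1.exp
    · simpa using hasDerivAt_mgf hint
  have := hmin.hasDerivAt_eq_zero hd
  linarith

/-- The square of a sub-Gaussian random variable has an exponential moment. -/
theorem exists_integrable_exp_mul_sq {X : Ω → ℝ} {c : NNReal} (h : HasSubgaussianMGF X c μ) :
    ∃ θ : ℝ, 0 < θ ∧ Integrable (fun ω => Real.exp (θ * X ω ^ 2)) μ := by
  obtain ⟨C, hC, hint⟩ := IsGaussian.exists_integrable_exp_sq (gaussianReal 0 1)
  have hX := h.aemeasurable
  set θ : ℝ := C / (c + 1) with hθ
  have hθ0 : 0 < θ := by positivity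
  refine ⟨θ, hθ0, ⟨by fun_prop, ?_⟩⟩
  rw [hasFiniteIntegral_iff_ofReal (ae_of_all _ fun _ => (Real.exp_pos _).le)]
  -- Gaussian linearization: exp(θx²) is the moment generating function of a standard normal g at
  -- √(2θ)x. After swapping integrals, the integral over X is at most exp(cθg²), and cθ ≤ C makes
  -- this integrable in g.
  have hg (x : ℝ) : ENNReal.ofReal (Real.exp (θ * x ^ 2))
      = ∫⁻ g, ENNReal.ofReal (Real.exp (√(2 * θ) * x * g)) ∂gaussianReal 0 1 := by
    rw [← ofReal_integral_eq_lintegral_ofReal (integrable_exp_mul_gaussianReal _)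
      (ae_of_all _ fun _ => (Real.exp_pos _).le)]
    have := congrFun (mgf_fun_id_gaussianReal (μ := 0) (v := 1)) (√(2 * θ) * x)
    rw [mgf] at this
    rw [this]
    congr 2
    rw [mul_pow, Real.sq_sqrt (by positivity)]
    push_cast; ring
  simp_rw [hg]
  rw [lintegral_lintegral_swap]
  · refine lt_of_le_of_lt (lintegral_mono fun g => ?_)
      ((hasFiniteIntegral_iff_ofReal (ae_of_all _ fun _ => (Real.exp_pos _).le)).1 hint.2)
    have e (ω : Ω) : √(2 * θ) * X ω * g = √(2 * θ) * g * X ω := by ring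
    simp_rw [e]
    rw [← ofReal_integral_eq_lintegral_ofReal (h.integrable_exp_mul _)
      (ae_of_all _ fun _ => (Real.exp_pos _).le)]
    refine ENNReal.ofReal_le_ofReal ((h.mgf_le _).trans (Real.exp_le_exp.2 ?_))
    rw [mul_pow, Real.sq_sqrt (by positivity), Real.norm_eq_abs, sq_abs]
    have h1 : (c : ℝ) * θ ≤ C := by
      rw [hθ, mul_div_assoc', div_le_iff₀ (by positivity)]
      nlinarith [c.2]
    have := mul_le_mul_of_nonneg_right h1 (sq_nonneg g)
    linarith
  · have : AEMeasurable (fun q : Ω × ℝ => X q.1) (μ.prod (gaussianReal 0 1)) :=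
      hX.comp_quasiMeasurePreserving Measure.quasiMeasurePreserving_fst
    unfold Function.uncurry
    fun_prop

theorem exp_le_one_add_add_sq_mul_exp_abs (x : ℝ) :
    Real.exp x ≤ 1 + x + x ^ 2 * Real.exp |x| := by
  rcases le_total |x| 1 with h | h
  · have h1 := (le_abs_self _).trans (Real.norm_exp_sub_one_sub_id_le (x := x) h)
    rw [Real.norm_eq_abs, sq_abs] at h1
    have h2 : 1 ≤ Real.exp |x| := Real.one_le_exp (abs_nonneg x)
    nlinarith [sq_nonneg x]
  · rcases le_total 0 x with h0 | h0
    · rw [abs_of_nonneg h0] at h ⊢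
      have := mul_le_mul_of_nonneg_right (one_le_pow₀ h (n := 2)) (Real.exp_pos x).le
      linarith
    · have h1 : Real.exp x ≤ 1 := Real.exp_le_one_iff.2 h0
      have h2 := Real.add_one_le_exp |x|
      rw [abs_of_nonpos h0] at h h2 ⊢
      nlinarith

/-- A centered random variable with an exponential moment is sub-exponential. -/
theorem exists_mgf_le_of_integrable_exp_abs {f : Ω → ℝ} (hf : Measurable f)
    (hf0 : ∫ ω, f ω ∂μ = 0) {θ : ℝ} (hθ : 0 < θ)
    (hint : Integrable (fun ω => Real.exp (θ * |f ω|)) μ) :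
    ∃ K : ℝ, 0 < K ∧ ∀ l, |l| ≤ θ / 2 →
      ∫⁻ ω, ENNReal.ofReal (Real.exp (l * f ω)) ∂μ ≤ ENNReal.ofReal (Real.exp (K * l ^ 2)) := by
  set M := ∫ ω, Real.exp (θ * |f ω|) ∂μ with hM
  have hM0 : 0 ≤ M := integral_nonneg fun _ => (Real.exp_pos _).le
  have hfi : Integrable f μ := by
    refine (hint.const_mul θ⁻¹).mono' hf.aestronglyMeasurable (ae_of_all _ fun ω => ?_)
    rw [Real.norm_eq_abs, le_inv_mul_iff₀ hθ]
    linarith [Real.add_one_le_exp (θ * |f ω|)]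
  refine ⟨8 / θ ^ 2 * M + 1, by positivity, fun l hl => ?_⟩
  have hpt (ω : Ω) : Real.exp (l * f ω)
      ≤ 1 + l * f ω + l ^ 2 * (8 / θ ^ 2) * Real.exp (θ * |f ω|) := by
    refine (exp_le_one_add_add_sq_mul_exp_abs _).trans (add_le_add le_rfl ?_)
    -- The exponent θ|f| is split in halves: one dominates exp|lf|, the other dominates f² through
    -- y²/2 ≤ e^y with y = θ|f|/2, which is the source of 8/θ².
    have h1 : Real.exp |l * f ω| ≤ Real.exp (θ / 2 * |f ω|) := by
      rw [abs_mul]; gcongr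
    have h2 : f ω ^ 2 ≤ 8 / θ ^ 2 * Real.exp (θ / 2 * |f ω|) := by
      have := Real.quadratic_le_exp_of_nonneg (x := θ / 2 * |f ω|) (by positivity)
      rw [div_mul_eq_mul_div, le_div_iff₀ (by positivity)]
      have h3 : (θ / 2 * |f ω|) ^ 2 = θ ^ 2 / 4 * f ω ^ 2 := by rw [mul_pow, sq_abs]; ring
      have h4 : 0 ≤ θ / 2 * |f ω| := by positivity
      rw [h3] at this
      linarith
    have h5 : Real.exp (θ * |f ω|) = Real.exp (θ / 2 * |f ω|) * Real.exp (θ / 2 * |f ω|) := by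
      rw [← Real.exp_add]; ring_nf
    rw [mul_pow, h5]
    calc l ^ 2 * f ω ^ 2 * Real.exp |l * f ω|
        ≤ l ^ 2 * (8 / θ ^ 2 * Real.exp (θ / 2 * |f ω|)) * Real.exp (θ / 2 * |f ω|) := by gcongr
      _ = _ := by ring
  have hi : Integrable (fun ω => 1 + l * f ω + l ^ 2 * (8 / θ ^ 2) * Real.exp (θ * |f ω|)) μ :=
    ((integrable_const _).add (hfi.const_mul _)).add (hint.const_mul _)
  refine (lintegral_mono fun ω => ENNReal.ofReal_le_ofReal (hpt ω)).trans ?_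
  rw [← ofReal_integral_eq_lintegral_ofReal hi
    (ae_of_all _ fun ω => (Real.exp_pos _).le.trans (hpt ω))]
  refine ENNReal.ofReal_le_ofReal ?_
  have hi' : Integrable (fun ω => 1 + l * f ω) μ := (integrable_const _).add (hfi.const_mul _)
  rw [integral_add hi' (hint.const_mul _), integral_add (integrable_const _) (hfi.const_mul _), integral_const_mul, integral_const_mul,
    hf0, ← hM]
  simp only [integral_const, probReal_univ, smul_eq_mul, mul_zero, one_mul, add_zero]
  refine le_trans ?_ (Real.add_one_le_exp _)
  nlinarith [sq_nonneg l]

/-- Bernstein's inequality with unspecified constants, one-sided. -/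
theorem exists_measure_sum_ge_le {f : Ω → ℝ} (hf : Measurable f) (hf0 : ∫ ω, f ω ∂μ = 0) {θ : ℝ}
    (hθ : 0 < θ) (hint : Integrable (fun ω => Real.exp (θ * |f ω|)) μ) :
    ∃ κ : ℝ, 0 < κ ∧ ∀ (N : ℕ) (s : ℝ), 0 < s →
      Measure.pi (fun _ : Fin N => μ) {Z | N * s ≤ ∑ k, f (Z k)}
        ≤ ENNReal.ofReal (Real.exp (-(κ * (N * (min 1 s * s))))) := by
  obtain ⟨K, hK, hmgf⟩ := exists_mgf_le_of_integrable_exp_abs hf hf0 hθ hint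
  -- The Chernoff parameter will be l₁ · min(1, s): it stays in the range θ/2 of the moment bound,
  -- and Kl ≤ s/2 lets the quadratic term use up only half of ls.
  set l₁ := min (θ / 2) (1 / (2 * K)) with hl₁
  have hl₁0 : 0 < l₁ := lt_min (by positivity) (by positivity)
  refine ⟨l₁ / 2, by positivity, fun N s hs => ?_⟩
  set e := min 1 s with he
  have he0 : 0 < e := lt_min one_pos hs
  set l := l₁ * e with hl
  have hl0 : 0 < l := by positivity
  have hlθ : |l| ≤ θ / 2 := by
    rw [abs_of_pos hl0]
    exact (mul_le_of_le_one_right hl₁0.le (min_le_left _ _)).trans (min_le_left _ _)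
  have hKl : K * l ≤ s / 2 := by
    have h1 : K * l₁ ≤ 1 / 2 := by
      calc K * l₁ ≤ K * (1 / (2 * K)) := by gcongr; exact min_le_right _ _
        _ = 1 / 2 := by field_simp
    calc K * l = K * l₁ * e := by ring
      _ ≤ 1 / 2 * s := by gcongr; exact min_le_right _ _
      _ = s / 2 := by ring
  have hone : ∫⁻ ω, ENNReal.ofReal (Real.exp (-(l * s))) * ENNReal.ofReal (Real.exp (l * f ω)) ∂μ
      ≤ ENNReal.ofReal (Real.exp (-(l₁ / 2 * (e * s)))) := by
    rw [lintegral_const_mul _ (by fun_prop)]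
    refine (mul_le_mul_right (hmgf l hlθ) _).trans ?_
    rw [← ENNReal.ofReal_mul (Real.exp_pos _).le, ← Real.exp_add]
    refine ENNReal.ofReal_le_ofReal (Real.exp_le_exp.2 ?_)
    have : K * l ^ 2 ≤ l * (s / 2) := by
      rw [sq, ← mul_assoc, mul_comm]; gcongr
    have e1 : l₁ / 2 * (e * s) = l * (s / 2) := by rw [hl]; ring
    rw [e1]; linarith
  have hrhs : ENNReal.ofReal (Real.exp (-(l₁ / 2 * (N * (e * s)))))
      = ENNReal.ofReal (Real.exp (-(l₁ / 2 * (e * s)))) ^ N := by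
    rw [← ENNReal.ofReal_pow (Real.exp_pos _).le, ← Real.exp_nat_mul]
    ring_nf
  rw [hrhs]
  refine le_trans ?_ (pow_le_pow_left' hone N)
  have := lintegral_pi_prod (ι := Fin N) μ (f := fun ω => ENNReal.ofReal (Real.exp (-(l * s))) *
    ENNReal.ofReal (Real.exp (l * f ω))) (by fun_prop)
  rw [Fintype.card_fin] at this
  rw [← this]
  refine meas_le_lintegral₀ ?_ fun Z hZ => ?_
  · refine Measurable.aemeasurable (Finset.measurable_fun_prod _ fun k _ => ?_)
    fun_prop
  · have e2 (k : Fin N) : ENNReal.ofReal (Real.exp (-(l * s))) *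
        ENNReal.ofReal (Real.exp (l * f (Z k))) = ENNReal.ofReal (Real.exp (l * f (Z k) - l * s)) := by
      rw [← ENNReal.ofReal_mul (Real.exp_pos _).le, ← Real.exp_add]; ring_nf
    simp_rw [e2]
    rw [← ENNReal.ofReal_prod_of_nonneg fun _ _ => (Real.exp_pos _).le, ← Real.exp_sum,
      ENNReal.one_le_ofReal, Real.one_le_exp_iff]
    simp only [Finset.sum_sub_distrib, ← Finset.mul_sum, Finset.sum_const, Finset.card_univ,
      Fintype.card_fin, nsmul_eq_mul]
    have := mul_le_mul_of_nonneg_left hZ.out hl0.le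
    linarith

/-- Bernstein's inequality with unspecified constants. -/
theorem exists_measure_abs_sum_ge_le {f : Ω → ℝ} (hf : Measurable f) (hf0 : ∫ ω, f ω ∂μ = 0)
    {θ : ℝ} (hθ : 0 < θ) (hint : Integrable (fun ω => Real.exp (θ * |f ω|)) μ) :
    ∃ κ : ℝ, 0 < κ ∧ ∀ (N : ℕ) (s : ℝ), 0 < s →
      Measure.pi (fun _ : Fin N => μ) {Z | N * s ≤ |∑ k, f (Z k)|}
        ≤ ENNReal.ofReal (2 * Real.exp (-(κ * (N * (min 1 s * s))))) := by
  obtain ⟨κ₁, hκ₁, h₁⟩ := exists_measure_sum_ge_le hf hf0 hθ hint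
  obtain ⟨κ₂, hκ₂, h₂⟩ := exists_measure_sum_ge_le (f := fun ω => -f ω) (μ := μ) hf.neg
    (by rw [integral_neg, hf0, neg_zero]) hθ (by simpa using hint)
  refine ⟨min κ₁ κ₂, lt_min hκ₁ hκ₂, fun N s hs => ?_⟩
  have hX : 0 ≤ (N : ℝ) * (min 1 s * s) := by positivity
  have hsub : {Z : Fin N → Ω | N * s ≤ |∑ k, f (Z k)|}
      ⊆ {Z | N * s ≤ ∑ k, f (Z k)} ∪ {Z | N * s ≤ ∑ k, -f (Z k)} := by
    intro Z hZ
    rw [Set.mem_ofPred_eq, le_abs] at hZ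
    simpa using hZ
  refine (measure_mono hsub).trans ((measure_union_le _ _).trans
    ((add_le_add (h₁ N s hs) (h₂ N s hs)).trans ?_))
  rw [← ENNReal.ofReal_add (Real.exp_pos _).le (Real.exp_pos _).le, two_mul]
  refine ENNReal.ofReal_le_ofReal (add_le_add ?_ ?_) <;> refine Real.exp_le_exp.2 (neg_le_neg ?_)
  · exact mul_le_mul_of_nonneg_right (min_le_left _ _) hX
  · exact mul_le_mul_of_nonneg_right (min_le_right _ _) hX

end SubExponential

/-! ## Existence of a deviation constant -/

section ExistsDeviationConstant

/-- The product z_i z_j has an exponential moment because |z_i z_j| ≤ (z_i² + z_j²)/2, and both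
squares have one; Bernstein's inequality applies after centering. -/
theorem exists_entry_tail {p : Type*} [Fintype p] {ρ : Measure (EuclideanSpace ℝ p)}
    [IsProbabilityMeasure ρ] (h : ∀ i, ∃ c, HasSubgaussianMGF (fun z => z i) c ρ) (i j : p) :
    ∃ κ : ℝ, 0 < κ ∧ ∀ (N : ℕ) (s : ℝ), 0 < s →
      Measure.pi (fun _ : Fin N => ρ) {Z | N * s ≤ |∑ k, (Z k i * Z k j - covMatrix ρ i j)|}
        ≤ ENNReal.ofReal (2 * Real.exp (-(κ * (N * (min 1 s * s))))) := by
  obtain ⟨ci, hi⟩ := h i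
  obtain ⟨cj, hj⟩ := h j
  obtain ⟨θi, hθi, hIi⟩ := exists_integrable_exp_mul_sq hi
  obtain ⟨θj, hθj, hIj⟩ := exists_integrable_exp_mul_sq hj
  have hi2 : MemLp (fun z : EuclideanSpace ℝ p => z i) 2 ρ := hi.memLp 2
  have hj2 : MemLp (fun z : EuclideanSpace ℝ p => z j) 2 ρ := hj.memLp 2
  have hcov : covMatrix ρ i j = ∫ z, z i * z j ∂ρ := by
    simp only [covMatrix, Matrix.of_apply]
    rw [covariance_eq_sub hi2 hj2, integral_eq_zero_of_hasSubgaussianMGF hi]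
    simp
  have hprod : Integrable (fun z : EuclideanSpace ℝ p => z i * z j) ρ := hi2.integrable_mul hj2
  set S := covMatrix ρ i j with hS
  set θ := min θi θj with hθ
  have hθ0 : 0 < θ := lt_min hθi hθj
  refine exists_measure_abs_sum_ge_le (f := fun z : EuclideanSpace ℝ p => z i * z j - S)
    (by fun_prop) ?_ hθ0 ?_
  · rw [integral_sub hprod (integrable_const _), ← hcov]; simp
  · refine ((hIi.add hIj).const_mul (Real.exp (θ * |S|))).mono' (by fun_prop)
      (ae_of_all _ fun z => ?_)
    rw [Real.norm_eq_abs, abs_of_pos (Real.exp_pos _)]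
    have h1 : |z i * z j - S| ≤ (z i ^ 2 + z j ^ 2) / 2 + |S| := by
      refine (abs_sub _ _).trans (add_le_add ?_ le_rfl)
      rw [abs_mul, ← sq_abs (z i), ← sq_abs (z j)]
      nlinarith [sq_nonneg (|z i| - |z j|)]
    have h2 : Real.exp (θ * |z i * z j - S|)
        ≤ Real.exp (θ * |S|) * Real.exp (θ * ((z i ^ 2 + z j ^ 2) / 2)) := by
      rw [← Real.exp_add]
      refine Real.exp_le_exp.2 ?_
      have := mul_le_mul_of_nonneg_left h1 hθ0.le
      linarith
    refine h2.trans (mul_le_mul_of_nonneg_left ?_ (Real.exp_pos _).le)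
    simp only [Pi.add_apply]
    have h3 : θ * z i ^ 2 ≤ θi * z i ^ 2 :=
      mul_le_mul_of_nonneg_right (min_le_left _ _) (sq_nonneg _)
    have h4 : θ * z j ^ 2 ≤ θj * z j ^ 2 :=
      mul_le_mul_of_nonneg_right (min_le_right _ _) (sq_nonneg _)
    rcases le_total (z i ^ 2) (z j ^ 2) with hle | hle
    · refine le_add_of_nonneg_of_le (Real.exp_pos _).le (Real.exp_le_exp.2 ?_)
      have := mul_le_mul_of_nonneg_left hle hθ0.le
      linarith
    · refine le_add_of_le_of_nonneg (Real.exp_le_exp.2 ?_) (Real.exp_pos _).le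
      have := mul_le_mul_of_nonneg_left hle hθ0.le
      linarith

theorem min_one_mul_le {L x : ℝ} (hL : 1 ≤ L) (hx : 0 ≤ x) :
    L * (min 1 x * x) ≤ min 1 (L * x) * (L * x) := by
  have h1 : min 1 x ≤ min 1 (L * x) := min_le_min le_rfl (le_mul_of_one_le_left hx hL)
  have h2 : 0 ≤ L * x := by positivity
  calc L * (min 1 x * x) = min 1 x * (L * x) := by ring
    _ ≤ _ := mul_le_mul_of_nonneg_right h1 h2

/-- With β² = DL, D = d² pays for passing from entries to the operator norm, and L enlarges the
entrywise threshold. -/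
theorem exists_isDeviationConstant {p : Type*} [Fintype p] [DecidableEq p] [Nonempty p]
    {ρ : Measure (EuclideanSpace ℝ p)} [IsProbabilityMeasure ρ]
    (h : ∀ i, ∃ c, HasSubgaussianMGF (fun z => z i) c ρ) : ∃ β, IsDeviationConstant ρ β := by
  choose κ' hκ' htail' using fun ij : p × p => exists_entry_tail h ij.1 ij.2
  obtain ⟨ij₀, hmin⟩ := Finite.exists_min κ'
  set κ := κ' ij₀
  have hκ : 0 < κ := hκ' ij₀
  set D : ℝ := (Fintype.card p : ℝ) ^ 2 with hD
  have hcard : (1 : ℝ) ≤ Fintype.card p := by exact_mod_cast Fintype.card_pos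
  have hD1 : 1 ≤ D := one_le_pow₀ hcard
  -- L ensures κL ≥ 1 + log(2D). Since N · min(1, x) · x ≥ 1, the logarithm absorbs the prefactor 2D
  -- of the union bound, and the remaining 1 supplies the required exponent.
  set L := max 1 ((1 + Real.log (2 * D)) / κ) with hL
  have hL1 : 1 ≤ L := le_max_left _ _
  have hlog : 0 ≤ Real.log (2 * D) := Real.log_nonneg (by linarith)
  have hκL : 1 + Real.log (2 * D) ≤ κ * L := by
    rw [← div_le_iff₀' hκ]; exact le_max_right _ _
  refine ⟨√(D * L), by positivity, fun N hN δ hδ => ?_⟩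
  rw [Real.sq_sqrt (by positivity)]
  have hN0 : (0 : ℝ) < N := by exact_mod_cast hN
  set r := 16 * √6 * (√((Fintype.card p : ℝ) / N) + (Fintype.card p : ℝ) / N) with hr
  set x := r + δ with hx
  have h6 : 1 ≤ √6 := Real.one_le_sqrt.2 (by norm_num)
  have hr0 : 0 ≤ r := by positivity
  have hx0 : 0 < x := by positivity
  have hthr : 16 * √6 * (D * L) * (√((Fintype.card p : ℝ) / N) + (Fintype.card p : ℝ) / N)
      + δ * (D * L) = D * (L * x) := by rw [hx, hr]; ring
  rw [hthr]
  -- The dimension term alone gives x ≥ √(1/N) + 1/N, which handles both branches of the minimum.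
  have hbig : 1 ≤ N * (min 1 x * x) := by
    have h1 : 1 / (N : ℝ) ≤ (Fintype.card p : ℝ) / N := by gcongr
    have hsum : √(1 / (N : ℝ)) + 1 / (N : ℝ) ≤ x := by
      have h2 : √(1 / (N : ℝ)) ≤ √((Fintype.card p : ℝ) / N) := Real.sqrt_le_sqrt h1
      have h3 : 0 ≤ √((Fintype.card p : ℝ) / N) + (Fintype.card p : ℝ) / N := by positivity
      have h4 : √((Fintype.card p : ℝ) / N) + (Fintype.card p : ℝ) / N ≤ r :=
        le_mul_of_one_le_left h3 (by linarith)
      linarith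
    have hN' : 0 < 1 / (N : ℝ) := by positivity
    have h5 := Real.sqrt_nonneg (1 / (N : ℝ))
    have hkey : 1 / (N : ℝ) ≤ min 1 x * x := by
      rcases le_total 1 x with hx1 | hx1
      · rw [min_eq_left hx1]; linarith
      · rw [min_eq_right hx1, ← sq]
        calc 1 / (N : ℝ) = √(1 / (N : ℝ)) ^ 2 := (Real.sq_sqrt hN'.le).symm
          _ ≤ x ^ 2 := by gcongr; linarith
    calc (1 : ℝ) = N * (1 / N) := by field_simp
      _ ≤ _ := mul_le_mul_of_nonneg_left hkey hN0.le
  have hδx : min (δ / (16 * √2)) (δ ^ 2 / 512) ≤ min 1 x * x := by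
    have h2 : 1 ≤ √2 := Real.one_le_sqrt.2 (by norm_num)
    have hδx' : δ ≤ x := by linarith
    rcases le_total 1 x with hx1 | hx1
    · rw [min_eq_left (b := x) hx1, one_mul]
      refine (min_le_left _ _).trans ((div_le_self hδ.le (by linarith)).trans hδx')
    · rw [min_eq_right (b := x) hx1, ← sq]
      refine (min_le_right _ _).trans ((div_le_self (sq_nonneg _) (by norm_num)).trans ?_)
      gcongr
  have hexp : N * min (δ / (16 * √2)) (δ ^ 2 / 512) + Real.log (2 * D)
      ≤ κ * (N * (min 1 (L * x) * (L * x))) := by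
    set Q := (N : ℝ) * (min 1 x * x) with hQ
    have h1 : κ * (L * Q) ≤ κ * (N * (min 1 (L * x) * (L * x))) := by
      have := mul_le_mul_of_nonneg_left (min_one_mul_le hL1 hx0.le) hN0.le
      refine mul_le_mul_of_nonneg_left ?_ hκ.le
      rw [hQ]; linarith
    have h2 : (1 + Real.log (2 * D)) * Q ≤ κ * L * Q :=
      mul_le_mul_of_nonneg_right hκL (by linarith)
    have h3 : N * min (δ / (16 * √2)) (δ ^ 2 / 512) ≤ Q := mul_le_mul_of_nonneg_left hδx hN0.le
    nlinarith
  have hsub : {Z : Fin N → EuclideanSpace ℝ p |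
      D * (L * x) ≤ opNorm (sampleCov (Matrix.of fun i j => Z i j) - covMatrix ρ)}
      ⊆ ⋃ ij ∈ (Finset.univ : Finset (p × p)),
        {Z | N * (L * x) ≤ |∑ k, (Z k ij.1 * Z k ij.2 - covMatrix ρ ij.1 ij.2)|} := by
    intro Z hZ
    by_contra hnot
    simp only [Finset.mem_univ, Set.iUnion_true, Set.mem_iUnion, Set.mem_ofPred_eq, not_exists,
      not_le] at hnot
    have hent (i j : p) :
        |(sampleCov (Matrix.of fun i j => Z i j) - covMatrix ρ) i j| < L * x := by
      have e : (sampleCov (Matrix.of fun i j => Z i j) - covMatrix ρ) i j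
          = (N : ℝ)⁻¹ * ∑ k, (Z k i * Z k j - covMatrix ρ i j) := by
        simp only [sampleCov, Matrix.sub_apply, Matrix.smul_apply, Matrix.mul_apply,
          Matrix.transpose_apply, Matrix.of_apply, Finset.sum_sub_distrib, Finset.sum_const,
          Finset.card_univ, Fintype.card_fin, nsmul_eq_mul, smul_eq_mul]
        field_simp
      rw [e, abs_mul, abs_of_pos (inv_pos.2 hN0), inv_mul_lt_iff₀ hN0]
      exact hnot (i, j)
    have hlt : ∑ i, ∑ j, |(sampleCov (Matrix.of fun i j => Z i j) - covMatrix ρ) i j|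
        < ∑ _i : p, ∑ _j : p, L * x :=
      Finset.sum_lt_sum_of_nonempty Finset.univ_nonempty fun i _ =>
        Finset.sum_lt_sum_of_nonempty Finset.univ_nonempty fun j _ => hent i j
    have := hZ.out.trans_lt ((opNorm_le_sum_abs _).trans_lt hlt)
    simp only [Finset.sum_const, Finset.card_univ, nsmul_eq_mul, hD] at this
    nlinarith
  refine (measure_mono hsub).trans ((measure_biUnion_finset_le _ _).trans ?_)
  have hLx : 0 < L * x := by positivity
  refine (Finset.sum_le_sum fun ij _ => (htail' ij N (L * x) hLx).trans
    (ENNReal.ofReal_le_ofReal (mul_le_mul_of_nonneg_left (Real.exp_le_exp.2 (neg_le_neg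
      (mul_le_mul_of_nonneg_right (hmin ij) ?_))) zero_le_two))).trans ?_
  · have : 0 ≤ min 1 (L * x) := le_min zero_le_one hLx.le
    positivity
  · rw [Finset.sum_const, nsmul_eq_mul, Finset.card_univ, Fintype.card_prod,
      ← ENNReal.ofReal_natCast, ← ENNReal.ofReal_mul (by positivity)]
    refine ENNReal.ofReal_le_ofReal ?_
    have e : ((Fintype.card p * Fintype.card p : ℕ) : ℝ) = D := by push_cast; rw [hD]; ring
    rw [e]
    calc D * (2 * Real.exp (-(κ * (N * (min 1 (L * x) * (L * x))))))
        = 2 * D * Real.exp (-(κ * (N * (min 1 (L * x) * (L * x))))) := by ring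
      _ = Real.exp (Real.log (2 * D)) * Real.exp (-(κ * (N * (min 1 (L * x) * (L * x))))) := by
          rw [Real.exp_log (by positivity)]
      _ ≤ _ := by
          rw [← Real.exp_add]
          refine Real.exp_le_exp.2 ?_
          linarith

end ExistsDeviationConstant

/-! ## The regressor is sub-Gaussian -/

section Regressor

variable {n m T : ℕ} (A : Matrix (Fin n) (Fin n) ℝ) (B : Matrix (Fin n) (Fin m) ℝ)
  {Pu : Fin T → Measure (EuclideanSpace ℝ (Fin m))}
  {Pw : Fin T → Measure (EuclideanSpace ℝ (Fin n))}

/-- Sums stay sub-Gaussian under arbitrary dependence; the constant only has to exist. -/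
theorem exists_hasSubgaussianMGF_sum {Ω ι : Type*} [MeasurableSpace Ω] {μ : Measure Ω}
    [IsProbabilityMeasure μ] (s : Finset ι) {f : ι → Ω → ℝ} (r : ι → ℝ)
    (h : ∀ i, ∃ c, HasSubgaussianMGF (f i) c μ) :
    ∃ c, HasSubgaussianMGF (fun ω => ∑ i ∈ s, r i * f i ω) c μ := by
  classical
  induction s using Finset.induction_on with
  | empty => exact ⟨0, by simp⟩
  | insert i s hi ih =>
    obtain ⟨c, hc⟩ := ih
    obtain ⟨c', hc'⟩ := h i
    refine ⟨_, ((hc'.const_mul (r i)).add hc).congr (ae_of_all _ fun ω => ?_)⟩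
    simp [Finset.sum_insert hi]

theorem IsSubGaussianLaw.hasSubgaussianMGF_coord {d : ℕ} {μ : Measure (EuclideanSpace ℝ (Fin d))}
    {σ : ℝ} (h : IsSubGaussianLaw μ σ) (j : Fin d) :
    HasSubgaussianMGF (fun x => x j) (Real.toNNReal (σ ^ 2)) μ := by
  have := h.2.2 (EuclideanSpace.single j 1) (by simp)
  simpa [EuclideanSpace.inner_single_left] using this

/-- Sub-Gaussianity propagates through the recursion by induction on time; beyond the horizon,
inputs and noises are 0 and have constant 0. -/
theorem exists_hasSubgaussianMGF_rowLaw [∀ t, IsProbabilityMeasure (Pu t)]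
    [∀ t, IsProbabilityMeasure (Pw t)] {σu σw : ℝ} (hu : ∀ t, IsSubGaussianLaw (Pu t) σu)
    (hw : ∀ t, IsSubGaussianLaw (Pw t) σw) (i : Fin n ⊕ Fin m) :
    ∃ c, HasSubgaussianMGF (fun z => z i) c (rowLaw A B Pu Pw) := by
  have hprob := isProbabilityMeasure_trialLaw (Pu := Pu) (Pw := Pw)
  have hmp (t : Fin T) : MeasurePreserving (fun ξ : Trial n m T => ξ t) (trialLaw Pu Pw)
      ((Pu t).prod (Pw t)) := measurePreserving_eval _ t
  have hin (t : ℕ) (j : Fin m) :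
      ∃ c, HasSubgaussianMGF (fun ξ : Trial n m T => ξ.input t j) c (trialLaw Pu Pw) := by
    by_cases ht : t < T
    · have h1 := measurePreserving_fst.comp (hmp ⟨t, ht⟩)
      have h2 := (hu ⟨t, ht⟩).hasSubgaussianMGF_coord j
      rw [← h1.map_eq] at h2
      refine ⟨_, (HasSubgaussianMGF.of_map h1.measurable.aemeasurable h2).congr
        (ae_of_all _ fun ξ => ?_)⟩
      simp [Trial.input, ht]
    · exact ⟨0, by simp [Trial.input, ht]⟩
  have hno (t : ℕ) (j : Fin n) :
      ∃ c, HasSubgaussianMGF (fun ξ : Trial n m T => ξ.noise t j) c (trialLaw Pu Pw) := by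
    by_cases ht : t < T
    · have h1 := measurePreserving_snd.comp (hmp ⟨t, ht⟩)
      have h2 := (hw ⟨t, ht⟩).hasSubgaussianMGF_coord j
      rw [← h1.map_eq] at h2
      refine ⟨_, (HasSubgaussianMGF.of_map h1.measurable.aemeasurable h2).congr
        (ae_of_all _ fun ξ => ?_)⟩
      simp [Trial.noise, ht]
    · exact ⟨0, by simp [Trial.noise, ht]⟩
  have hst (t : ℕ) : ∀ j : Fin n,
      ∃ c, HasSubgaussianMGF (fun ξ : Trial n m T => state A B ξ t j) c (trialLaw Pu Pw) := by
    induction t with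
    | zero => exact fun j => ⟨0, HasSubgaussianMGF.fun_zero⟩
    | succ t ih =>
      intro j
      obtain ⟨c₁, h₁⟩ := exists_hasSubgaussianMGF_sum Finset.univ (A j) ih
      obtain ⟨c₂, h₂⟩ := exists_hasSubgaussianMGF_sum Finset.univ (B j) (hin t)
      obtain ⟨c₃, h₃⟩ := hno t j
      exact ⟨_, (h₁.add h₂).add h₃⟩
  have hz := (measurable_regressor (T := T) A B (T - 1)).aemeasurable (μ := trialLaw Pu Pw)
  have hcoord : ∃ c, HasSubgaussianMGF (fun ξ : Trial n m T => regressor A B ξ (T - 1) i) c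
      (trialLaw Pu Pw) := by
    rcases i with j | j
    · exact hst (T - 1) j
    · exact hin (T - 1) j
  obtain ⟨c, hc⟩ := hcoord
  refine ⟨c, ⟨fun t => ?_, fun t => ?_⟩⟩
  · rw [rowLaw, integrable_map_measure (by fun_prop) hz]
    exact hc.integrable_exp_mul t
  · rw [rowLaw, mgf_map hz (by fun_prop)]
    exact hc.mgf_le t

end Regressor

end VARX

theorem corollary3 :
    ∃ c₁ c₅ c₆ : ℝ, 0 < c₁ ∧ 0 < c₅ ∧ 0 < c₆ ∧
      ∀ (n m T : ℕ), 1 ≤ n → 1 ≤ T →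
      ∀ (A : Matrix (Fin n) (Fin n) ℝ) (B : Matrix (Fin n) (Fin m) ℝ)
        (q R : ℝ), 0 ≤ q → q ≤ 1 → 0 < R → VARX.theta A B ∈ VARX.lqBall q R →
      ∀ (σu σw : ℝ)
        (Pu : Fin T → Measure (EuclideanSpace ℝ (Fin m)))
        (Pw : Fin T → Measure (EuclideanSpace ℝ (Fin n))),
        (∀ t, IsProbabilityMeasure (Pu t)) → (∀ t, IsProbabilityMeasure (Pw t)) →
        (∀ t, VARX.IsSubGaussianLaw (Pu t) σu) → (∀ t, VARX.IsSubGaussianLaw (Pw t) σw) →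
        0 < VARX.gammaMin (VARX.covMatrix (VARX.rowLaw A B Pu Pw)) →
        (∃ β : ℝ, VARX.IsDeviationConstant (VARX.rowLaw A B Pu Pw) β) ∧
        ∀ β : ℝ, VARX.IsDeviationConstant (VARX.rowLaw A B Pu Pw) β →
        ∀ (N : ℕ),
          c₁ * β ^ 4 / VARX.gammaMin (VARX.covMatrix (VARX.rowLaw A B Pu Pw)) ^ 2 * ((n : ℝ) + m)
            ≤ N →
        ∀ {Ω : Type*} [MeasurableSpace Ω] (P : Measure Ω) [IsProbabilityMeasure P]
          (ξ : Fin N → Ω → VARX.Trial n m T),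
          (∀ i, HasLaw (ξ i) (VARX.trialLaw Pu Pw) P) → iIndepFun ξ P →
          P {ω | ¬ ((∃ Θhat, VARX.IsSolution
                      (VARX.responseMatrix A B fun i => ξ i ω)
                      (VARX.measurementMatrix A B fun i => ξ i ω)
                      (4 * VARX.alpha σw β (VARX.covMatrix (VARX.rowLaw A B Pu Pw))
                        * √(((n : ℝ) + m) / N)) Θhat) ∧
                    ∀ Θhat, VARX.IsSolution
                      (VARX.responseMatrix A B fun i => ξ i ω)
                      (VARX.measurementMatrix A B fun i => ξ i ω)
                      (4 * VARX.alpha σw β (VARX.covMatrix (VARX.rowLaw A B Pu Pw))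
                        * √(((n : ℝ) + m) / N)) Θhat →
                      VARX.opNorm (Θhat - VARX.theta A B)
                        ≤ 24 * VARX.alpha σw β (VARX.covMatrix (VARX.rowLaw A B Pu Pw))
                            / VARX.gammaMin (VARX.covMatrix (VARX.rowLaw A B Pu Pw))
                          * √(((n : ℝ) + m) / N))}
            ≤ ENNReal.ofReal (c₅ * Real.exp (-c₆ * ((n : ℝ) + m))) := by
  refine ⟨(64 * √6 + 2) ^ 2, 2, 1 / 512, by positivity, two_pos, by norm_num, ?_⟩
  intro n m T hn hT A B q R _ _ _ _ σu σw Pu Pw _ _ hu hw hγ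
  have := VARX.isProbabilityMeasure_trialLaw (Pu := Pu) (Pw := Pw)
  have := VARX.isProbabilityMeasure_rowLaw (A := A) (B := B) (Pu := Pu) (Pw := Pw)
  have : Nonempty (Fin n ⊕ Fin m) := ⟨Sum.inl ⟨0, hn⟩⟩
  refine ⟨VARX.exists_isDeviationConstant (VARX.exists_hasSubgaussianMGF_rowLaw A B hu hw), ?_⟩
  intro β hβ N hN Ω _ P _ ξ hlaw hind
  have hξ (i : Fin N) : AEMeasurable (ξ i) P := (hlaw i).aemeasurable
  -- Independence and equal laws identify the joint law of the trials with the product measure.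
  have hmap : P.map (fun ω i => ξ i ω) = Measure.pi fun _ : Fin N => VARX.trialLaw Pu Pw := by
    rw [(iIndepFun_iff_map_fun_eq_pi_map hξ).1 hind]
    congr 1
    exact funext fun i => (hlaw i).map_eq
  -- The inequality between a measure and its image holds for arbitrary sets, so the event need not
  -- be shown measurable.
  have hle := Measure.le_map_apply (μ := P) (aemeasurable_pi_lambda (fun ω i => ξ i ω) hξ)
    {ζ | ¬ VARX.ErrorBound A B σw β (VARX.covMatrix (VARX.rowLaw A B Pu Pw)) ζ}
  rw [hmap] at hle
  exact hle.trans (VARX.measure_not_errorBound_le hw hn hT hγ hβ hN)
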